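/- **Setting.** Let $G$ be a finite directed multigraph (cycles allowed) with noiseless edges of capacity $c_e\ge 0$ bits per unit of time, with $n$ sources and $T$ receivers placed at its nodes. Let $1\le k\le n$, let $\rho>0$ be a constant and let $m$ be the smallest natural number with $m\ge \rho k\log(n/k)$. At each time, independently of other times, the vector of source messages $M=(M_1,\dots,M_n)\in\mathbb R^n$ is drawn from the same discrete law. Let $i_1,\dots,i_m$ be distinct indices (the active sources), with $H(M_{i_j})<\infty$ (entropies in bits). Suppose that the sources are $k$-sparsely correlated: there is an $n\times n$ real matrix $\Phi$ such that every message vector $\mu$ that occurs is $\mu=\Phi\mu'$ for some $\mu'$ with at most $k$ non-zero coordinates, and the $m\times n$ matrix $\Phi_S$ of the rows $i_1,\dots,i_m$ of $\Phi$ satisfies the restricted isometry property, i.e. there are $\delta_k,\delta_{2k},\delta_{3k}>0$ with $\delta_k+\delta_{2k}+\delta_{3k}<1$ and $(1-\delta_s)\|v\|_2^2\le\|\Phi_S v\|_2^2\le(1+\delta_s)\|v\|_2^2$ for every $v$ with at most $s$ non-zero coordinates, $s\in\{k,2k,3k\}$. **Scheme.** In sparse distributed compression with independent coding (SDCIC)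 with block length $N$, each active source separately encodes its block of $N$ messages into symbols of a finite field, the other sources are idle, and the symbols are sent through $G$ by a linear network code (a finite schedule of transmissions, each sending along one edge a linear combination of the symbols available at its tail). Each receiver first decodes the blocks of the $m$ active sources, and then, for each time of the block, computes a minimizer of $\|x\|_1$ subject to $\Phi_S x=y$, where $y$ is the vector of decoded active messages of this time. The network supports SDCIC if for all $\eta,\varepsilon>0$ and all sufficiently large $N$ there is such a code that carries at most $N(c_e+\eta)$ bits on every edge $e$, for which (i) if the active sources are treated as independent (same individual laws), the probability that some receiver decodes them wrongly is at most $\varepsilon$, and (ii) for the actual correlated sources, the probability that some receiver does not recover the $k$-sparse vectors $\mu'$ and thereby the messages $\mu=\Phi\mu'$ of all $n$ sources is at most $\varepsilon$. For $A\subseteq\{1,\dots,m\}$ let $\operatorname{mincut}(A,t)$ be the minimum total capacity of the edges leaving a set of nodes that contains the sources $i_j$, $j\in A$, and does not contain receiver $t$ ($\infty$ if there is no such set). **Complexity.** Decoders are algebraic computation trees over $\mathbb R$; every arithmetic operation and every comparison costs one step, and the number of steps is the length of the longest path. $CX_{cs}^{noiseless}(m,n)$ is the least number of steps of a tree that, given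 any $m\times n$ matrix $A$ and any $y$ in its range, outputs a minimizer of $\|x\|_1$ subject to $Ax=y$. For a given code and receiver, $CX_{indep}^{nc}(m)$ is the least number of steps, divided by $N$, of a tree that decodes the blocks of the $m$ active sources from the received symbols. The decoding complexity of a modular decoder, which runs a network decoder once and then a compressive sensing decoder at each of the $N$ times, is its number of steps divided by $N$. **Theorem.** (a) The network supports SDCIC if and only if $\operatorname{mincut}(A,t)\ge\sum_{j\in A}H(M_{i_j})$ for every receiver $t$ and every $A\subseteq\{1,\dots,m\}$. In particular, the min-cut rate $R$ between each receiver and the active sources has to satisfy $$R\ \ge\ \sum_{j=1}^m H(M_{i_j}),$$ and this condition at every receiver suffices if all active sources are placed at one node. (b) For every SDCIC code (of block length $N\ge1$) and every receiver, the least decoding complexity of a modular decoder is attained and equals $CX_{indep}^{nc}(m)+CX_{cs}^{noiseless}(m,n)$. -/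

import Mathlib

open scoped NNReal ENNReal

noncomputable section

/-! ### Discrete sources -/

/-- Shannon entropy, in bits, of a discrete law. -/
def entropy {α : Type*} (q : PMF α) : ℝ :=
  (∑' a, Real.negMulLog (q a).toReal) / Real.log 2

/-- The entropy series of a discrete law converges. -/
def FiniteEntropy {α : Type*} (q : PMF α) : Prop :=
  Summable fun a => Real.negMulLog (q a).toReal

/-- Law of the message `M i` of source `i`, when `p` is the joint law of `(M 1, ..., M n)`. -/
def sourceLaw {n : ℕ} (p : PMF (Fin n → ℝ)) (i : Fin n) : PMF ℝ :=
  p.map fun μ => μ i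

/-- Probability of the event `B` under the discrete distribution with mass function `w`. -/
def massOf {α : Type*} (w : α → ℝ≥0∞) (B : Set α) : ℝ≥0∞ :=
  ∑' x, B.indicator w x

/-- Mass function of a block of `N` independent draws of the source vector (memoryless in time,
with the true correlation between the sources). -/
def blockMass {n : ℕ} (p : PMF (Fin n → ℝ)) (N : ℕ) (x : Fin N → Fin n → ℝ) : ℝ≥0∞ :=
  ∏ τ, p (x τ)

/-- Mass function of a block of `N` messages of the active sources `act 0, ..., act (m - 1)`, when
these sources are treated as independent: same individual laws, no correlation. -/
def indepBlockMass {n m : ℕ} (p : PMF (Fin n → ℝ)) (act : Fin m ↪ Fin n) (N : ℕ)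
    (y : Fin N → Fin m → ℝ) : ℝ≥0∞ :=
  ∏ τ, ∏ j, sourceLaw p (act j) (y τ j)

/-! ### Sparse vectors, restricted isometry, sparsely correlated sources -/

/-- At most `k` coordinates of `v` are non-zero. -/
def IsSparse {n : ℕ} (k : ℕ) (v : Fin n → ℝ) : Prop :=
  {i | v i ≠ 0}.ncard ≤ k

/-- Restricted isometry property of order `s` with constant `δ` (Euclidean norms). -/
def RIP {m n : ℕ} (A : Matrix (Fin m) (Fin n) ℝ) (s : ℕ) (δ : ℝ) : Prop :=
  ∀ v : Fin n → ℝ, IsSparse s v →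
    (1 - δ) * ∑ i, v i ^ 2 ≤ ∑ j, (A.mulVec v) j ^ 2 ∧
      ∑ j, (A.mulVec v) j ^ 2 ≤ (1 + δ) * ∑ i, v i ^ 2

/-- Restricted isometry with constants satisfying `δ_k + δ_{2k} + δ_{3k} < 1`. -/
def SatisfiesRIP {m n : ℕ} (A : Matrix (Fin m) (Fin n) ℝ) (k : ℕ) : Prop :=
  ∃ δ₁ δ₂ δ₃ : ℝ, 0 < δ₁ ∧ 0 < δ₂ ∧ 0 < δ₃ ∧ δ₁ + δ₂ + δ₃ < 1 ∧
    RIP A k δ₁ ∧ RIP A (2 * k) δ₂ ∧ RIP A (3 * k) δ₃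

/-- The rows of `Φ` that belong to the active sources. -/
def activeRows {n m : ℕ} (Φ : Matrix (Fin n) (Fin n) ℝ) (act : Fin m ↪ Fin n) :
    Matrix (Fin m) (Fin n) ℝ :=
  Φ.submatrix act id

/-- The sources with joint law `p` are `k`-sparsely correlated, with transform matrix `Φ`: every
message vector that occurs is `Φ μ'` with `μ'` `k`-sparse, and the rows of `Φ` that belong to the
active sources form a restricted isometry. -/
structure SparselyCorrelated {n m : ℕ} (p : PMF (Fin n → ℝ)) (Φ : Matrix (Fin n) (Fin n) ℝ)
    (k : ℕ) (act : Fin m ↪ Fin n) : Prop where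
  sparse : ∀ μ ∈ p.support, ∃ μ' : Fin n → ℝ, IsSparse k μ' ∧ μ = Φ.mulVec μ'
  rip : SatisfiesRIP (activeRows Φ act) k

/-! ### Multicast networks -/

/-- A noiseless network: a directed multigraph (cycles allowed) with edge capacities in bits per
unit of time, `n` sources and `T` receivers placed at its nodes. -/
structure Network (V E : Type*) (n T : ℕ) where
  src : E → V
  tgt : E → V
  cap : E → ℝ≥0
  source : Fin n → V
  receiver : Fin T → V

namespace Network

variable {V E : Type*} {n T : ℕ}

/-- Total capacity of the edges that leave the set of nodes `W`. -/
def cutCapacity [Fintype E] (G : Network V E n T) (W : Set V) : ℝ≥0 :=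
  ∑ e, {e | G.src e ∈ W ∧ G.tgt e ∉ W}.indicator G.cap e

/-- Min-cut between the active sources `act j`, `j ∈ A`, and the receiver `t`
(`⊤` if nothing separates them). -/
def minCut [Fintype E] (G : Network V E n T) {m : ℕ} (act : Fin m ↪ Fin n)
    (A : Finset (Fin m)) (t : Fin T) : ℝ≥0∞ :=
  ⨅ W ∈ {W : Set V | (∀ j ∈ A, G.source (act j) ∈ W) ∧ G.receiver t ∉ W},
    (G.cutCapacity W : ℝ≥0∞)

end Network

/-! ### Linear network codes -/

/-- A linear network code over the finite field `F` for the active sources. Source `act j` holds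
`len j` symbols of `F`. There are `K` transmissions, one after the other; the `s`-th sends one
symbol of `F` along `edge s`, a linear combination of the symbols that the tail of this edge has at
that moment: those of the active sources placed there and those that it has received before. -/
structure LinearNetworkCode {V E : Type*} {n T m : ℕ} (G : Network V E n T)
    (act : Fin m ↪ Fin n) where
  F : Type
  [field : Field F]
  [fintype : Fintype F]
  len : Fin m → ℕ
  K : ℕ
  edge : Fin K → E
  srcCoeff : Fin K → (j : Fin m) → Fin (len j) → F
  relayCoeff : Fin K → Fin K → F
  src_local : ∀ s j l, srcCoeff s j l ≠ 0 → G.source (act j) = G.src (edge s)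
  relay_local : ∀ s r, relayCoeff s r ≠ 0 → r < s ∧ G.tgt (edge r) = G.src (edge s)

namespace LinearNetworkCode

variable {V E : Type*} {n T m : ℕ} {G : Network V E n T} {act : Fin m ↪ Fin n}

instance (C : LinearNetworkCode G act) : Field C.F := C.field

instance (C : LinearNetworkCode G act) : Fintype C.F := C.fintype

/-- The symbol sent in the `s`-th transmission when the sources hold the symbols `w`. -/
def symbol (C : LinearNetworkCode G act) (w : (j : Fin m) → Fin (C.len j) → C.F)
    (s : Fin C.K) : C.F :=
  ∑ j, ∑ l, C.srcCoeff s j l * w j l +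
    ∑ r : {r : Fin C.K // r < s}, C.relayCoeff s r.1 * symbol C w r.1
termination_by s
decreasing_by exact r.2

/-- Names of the symbols that the receiver `t` ends up with: those of the transmissions into its
node, and those of active sources placed at its node. -/
abbrev Received (C : LinearNetworkCode G act) (t : Fin T) : Type :=
  {s : Fin C.K // G.tgt (C.edge s) = G.receiver t} ⊕
    (Σ j : {j : Fin m // G.source (act j) = G.receiver t}, Fin (C.len j.1))

/-- What the receiver `t` ends up with when the sources hold the symbols `w`. -/
def received (C : LinearNetworkCode G act) (t : Fin T)
    (w : (j : Fin m) → Fin (C.len j) → C.F) : C.Received t → C.F :=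
  Sum.elim (fun s => C.symbol w s.1) (fun a => w a.1.1 a.2)

/-- Bits carried by the edge `e` in the whole schedule. -/
def edgeBits (C : LinearNetworkCode G act) (e : E) : ℝ :=
  Nat.card {s : Fin C.K // C.edge s = e} * Real.logb 2 (Fintype.card C.F)

end LinearNetworkCode

/-! ### Step-counting model: algebraic computation trees over the reals -/

/-- One arithmetic operation; its operands are registers with names in `ι`. -/
inductive Instr (ι : Type) : Type
  | const (c : ℝ) : Instr ι
  | add (a b : ι) : Instr ι
  | sub (a b : ι) : Instr ι
  | mul (a b : ι) : Instr ι
  | div (a b : ι) : Instr ι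

namespace Instr

def eval {ι : Type} (v : ι → ℝ) : Instr ι → ℝ
  | const c => c
  | add a b => v a + v b
  | sub a b => v a - v b
  | mul a b => v a * v b
  | div a b => v a / v b

def rename {ι ι' : Type} (f : ι → ι') : Instr ι → Instr ι'
  | const c => const c
  | add a b => add (f a) (f b)
  | sub a b => sub (f a) (f b)
  | mul a b => mul (f a) (f b)
  | div a b => div (f a) (f b)

end Instr

/-- An algebraic computation tree that reads the registers `ι` and outputs the values `κ`. It
halts, naming the registers that hold the output, or computes one new register (`none` in
`Option ι`), or tests the sign of a register. -/
inductive CompTree (κ : Type) : Type → Type 1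
  | halt {ι : Type} (out : κ → ι) : CompTree κ ι
  | step {ι : Type} (o : Instr ι) (next : CompTree κ (Option ι)) : CompTree κ ι
  | test {ι : Type} (a : ι) (pos nonpos : CompTree κ ι) : CompTree κ ι

namespace CompTree

variable {κ : Type}

open Classical in
/-- The output of a tree on the input `v`. -/
def eval : {ι : Type} → CompTree κ ι → (ι → ℝ) → κ → ℝ
  | _, halt out, v => fun x => v (out x)
  | _, step o next, v => next.eval fun a => a.elim (o.eval v) v
  | _, test a pos nonpos, v => if 0 < v a then pos.eval v else nonpos.eval v

/-- Worst-case number of steps: each operation and each test counts one. -/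
def steps : {ι : Type} → CompTree κ ι → ℕ
  | _, halt _ => 0
  | _, step _ next => next.steps + 1
  | _, test _ pos nonpos => max pos.steps nonpos.steps + 1

/-- The same tree on registers with other names. -/
def rename : {ι ι' : Type} → (ι → ι') → CompTree κ ι → CompTree κ ι'
  | _, _, f, halt out => halt (f ∘ out)
  | _, _, f, step o next => step (o.rename f) (next.rename (Option.map f))
  | _, _, f, test a pos nonpos => test (f a) (pos.rename f) (nonpos.rename f)

/-- Run `P`, then run `Q`, which reads the original registers and the output of `P`. -/
def andThen {κ' : Type} : {ι : Type} → CompTree κ ι → CompTree κ' (ι ⊕ κ) → CompTree κ' ι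
  | _, halt out, Q => Q.rename (Sum.elim id out)
  | _, step o next, Q => step o (next.andThen (Q.rename (Sum.map some id)))
  | _, test a pos nonpos, Q => test a (pos.andThen Q) (nonpos.andThen Q)

/-- Run `Q` successively on the `N` inputs that the registers `g 0`, ..., `g (N - 1)` hold, and
output all the results. -/
def runEach {θ : Type} (Q : CompTree κ θ) :
    (N : ℕ) → {ι : Type} → (Fin N → θ → ι) → CompTree (Fin N × κ) ι
  | 0, _, _ => halt fun x => x.1.elim0
  | N + 1, _, g =>
    (Q.rename (g 0)).andThen
      ((runEach Q N fun τ a => Sum.inl (g τ.succ a)).andThen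
        (halt fun x => Fin.cases (Sum.inl (Sum.inr x.2)) (fun τ => Sum.inr (τ, x.2)) x.1))

end CompTree

/-! ### The compressive sensing decoder -/

/-- `x` is a solution of: minimize the `L¹` norm of `x` subject to `A x = y`. -/
def IsL1Minimizer {m n : ℕ} (A : Matrix (Fin m) (Fin n) ℝ) (y : Fin m → ℝ)
    (x : Fin n → ℝ) : Prop :=
  A.mulVec x = y ∧ ∀ z : Fin n → ℝ, A.mulVec z = y → ∑ i, |x i| ≤ ∑ i, |z i|

/-- The tree `Q`, given the entries of an arbitrary `m × n` matrix `A` and an arbitrary vector `y`,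
solves the `L¹` minimization problem whenever it is feasible. -/
def SolvesL1 {m n : ℕ} (Q : CompTree (Fin n) ((Fin m × Fin n) ⊕ Fin m)) : Prop :=
  ∀ (A : Matrix (Fin m) (Fin n) ℝ) (y : Fin m → ℝ), (∃ x, A.mulVec x = y) →
    IsL1Minimizer A y (Q.eval (Sum.elim (fun a => A a.1 a.2) y))

/-- Complexity of the noiseless compressive sensing optimization with `m` measurements of a vector
of length `n`: least worst-case number of steps that solves it. -/
def csComplexity (m n : ℕ) : ℕ :=
  sInf {d | ∃ Q : CompTree (Fin n) ((Fin m × Fin n) ⊕ Fin m), SolvesL1 Q ∧ Q.steps = d}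

/-! ### Sparse distributed compression with independent coding -/

/-- A code of block length `N` for sparse distributed compression with independent coding. Each
active source encodes its own block of `N` messages; the codewords travel through a linear network
code; each receiver maps what it has received to the blocks of all active sources. The other
sources are idle. `label` is the numerical representation in which receivers read field symbols. -/
structure SDCICCode {V E : Type*} {n T m : ℕ} (G : Network V E n T) (act : Fin m ↪ Fin n)
    (N : ℕ) extends LinearNetworkCode G act where
  enc : (j : Fin m) → (Fin N → ℝ) → Fin (len j) → F
  label : F ↪ ℝ
  dec : (t : Fin T) → (toLinearNetworkCode.Received t → F) → Fin N → Fin m → ℝ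

namespace SDCICCode

variable {V E : Type*} {n T m N : ℕ} {G : Network V E n T} {act : Fin m ↪ Fin n}

/-- What the receiver `t` has received when `y τ j` is the message of source `act j` at time `τ`. -/
def receivedFrom (C : SDCICCode G act N) (t : Fin T) (y : Fin N → Fin m → ℝ) :
    C.Received t → C.F :=
  C.received t fun j => C.enc j fun τ => y τ j

/-- Some receiver fails to decode the blocks of the active sources. -/
def networkError (C : SDCICCode G act N) : Set (Fin N → Fin m → ℝ) :=
  {y | ∃ t, C.dec t (C.receivedFrom t y) ≠ y}

/-- The tree `P` carries out the network decoding of receiver `t`. -/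
def ComputesDec (C : SDCICCode G act N) (t : Fin T)
    (P : CompTree (Fin N × Fin m) (C.Received t)) : Prop :=
  ∀ z : C.Received t → C.F, P.eval (fun a => C.label (z a)) = fun a => C.dec t z a.1 a.2

/-- Complexity, per unit of time, of the network decoder of the code at the receiver `t`. -/
def ncComplexity (C : SDCICCode G act N) (t : Fin T) : ℝ :=
  (sInf {d | ∃ P, C.ComputesDec t P ∧ P.steps = d} : ℕ) / (N : ℝ)

/-- A modular decoder of the receiver `t`: a network decoder for the active sources and a
compressive sensing decoder. -/
structure Decoder (C : SDCICCode G act N) (t : Fin T) where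
  net : CompTree (Fin N × Fin m) (C.Received t)
  net_correct : C.ComputesDec t net
  cs : CompTree (Fin n) ((Fin m × Fin n) ⊕ Fin m)
  cs_correct : SolvesL1 cs

namespace Decoder

variable {C : SDCICCode G act N} {t : Fin T}

/-- The whole decoder as one computation. It reads the received symbols and the matrix of active
rows, first decodes the active sources, and then, at each time of the block, runs the compressive
sensing decoder on the messages of the active sources at this time. -/
def program (D : Decoder C t) :
    CompTree (Fin N × Fin n) (C.Received t ⊕ (Fin m × Fin n)) :=
  (D.net.rename Sum.inl).andThen
    (D.cs.runEach N fun τ => Sum.elim (fun a => Sum.inl (Sum.inr a)) (fun j => Sum.inr (τ, j)))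

/-- The sparse vector that the decoder computes for the time `τ`, if `x` is the block of messages of
all sources. -/
def output (D : Decoder C t) (Φ : Matrix (Fin n) (Fin n) ℝ) (x : Fin N → Fin n → ℝ)
    (τ : Fin N) (i : Fin n) : ℝ :=
  D.program.eval
    (Sum.elim (fun a => C.label (C.receivedFrom t (fun τ' j => x τ' (act j)) a))
      (fun a => activeRows Φ act a.1 a.2))
    (τ, i)

/-- Worst-case number of steps of the whole decoder, per unit of time. -/
def complexity (D : Decoder C t) : ℝ :=
  (D.program.steps : ℝ) / (N : ℝ)

end Decoder

/-- Some receiver does not recover the messages of all `n` sources in the whole block. -/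
def sourceError (C : SDCICCode G act N) (Φ : Matrix (Fin n) (Fin n) ℝ) (k : ℕ)
    (D : (t : Fin T) → C.Decoder t) : Set (Fin N → Fin n → ℝ) :=
  {x | ∃ t τ, ¬ (IsSparse k ((D t).output Φ x τ) ∧ Φ.mulVec ((D t).output Φ x τ) = x τ)}

/-- The code has error at most `ε`: the active sources are decoded when they are treated as
independent, and all `n` correlated sources are recovered by every modular decoder. -/
structure Reliable (C : SDCICCode G act N) (p : PMF (Fin n → ℝ))
    (Φ : Matrix (Fin n) (Fin n) ℝ) (k : ℕ) (ε : ℝ) : Prop where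
  indep : massOf (indepBlockMass p act N) C.networkError ≤ ENNReal.ofReal ε
  all : ∀ D : (t : Fin T) → C.Decoder t,
    massOf (blockMass p N) (C.sourceError Φ k D) ≤ ENNReal.ofReal ε

end SDCICCode

/-- The network supports sparse distributed compression with independent coding: for arbitrarily
small excess `η` over the capacities and error `ε`, all large block lengths admit a code. -/
def SupportsSDCIC {V E : Type*} {n T m : ℕ} (G : Network V E n T) (p : PMF (Fin n → ℝ))
    (Φ : Matrix (Fin n) (Fin n) ℝ) (k : ℕ) (act : Fin m ↪ Fin n) : Prop :=
  ∀ η > (0 : ℝ), ∀ ε > (0 : ℝ), ∀ᶠ N : ℕ in Filter.atTop, ∃ C : SDCICCode G act N,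
    (∀ e, C.edgeBits e ≤ N * (G.cap e + η)) ∧ C.Reliable p Φ k ε

end

/-! Part (a) is a cut-set theorem for independent sources, with compressive sensing added at the
receivers.

Converse: requirement (i) treats the active sources as independent, so a typical block of the
sources in `A` has probability about `2 ^ (-N * ∑ H)`. If a cut of capacity below `∑ H` separates
them from a receiver, then for each choice of the other blocks at most about `2 ^ (N * capacity)`
blocks can be decoded there. The correctly decoded typical blocks therefore have vanishing
probability (`massOf_decoded_le`, `le_minCut_of_supportsSDCIC`).

Achievability: by the equipartition property, `N * (H + δ)` bits describe all but a small fraction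
of the blocks of a source (`eventually_exists_typical_finset`). These bits are multicast by random
linear coding over `ZMod 2` in `D` rounds. A receiver decodes if every non-zero difference `w` of
source words is seen by some functional known there. The set of nodes that see `w` grows in each
round unless all transmissions leaving it vanish at `w`, which has probability at most `2 ^ (-cut)`.
A potential function bounds the failure probability, and a union bound over `w` and the receivers
yields a code (`sum_failureBound_le`, `exists_transmissions`, `exists_multicast_code`). Cycles do no
harm, since time is unrolled into rounds; the delay costs at most `|E|` rounds and becomes
negligible for large `D`.

Requirement (ii) then follows: each active source keeps its marginal law, so the same union bound
applies without independence, and the isometry property makes the `L¹` minimizer equal to the sparse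
vector (`IsL1Minimizer.eq_of_isSparse`).

Part (b): the cost of running trees one after another is exactly additive, so the two modules can be
optimized separately. What must be shown is that both minima range over non-empty sets: a network
decoder is a finite table, and `L¹` minimization reduces to comparing finitely many basic solutions
(`exists_solvesL1`). -/

/-! ### Semantics and cost of composed computation trees -/

namespace CompTree

variable {κ κ' : Type}

lemma _root_.Instr.eval_rename {ι ι' : Type} (f : ι → ι') (v : ι' → ℝ) (o : Instr ι) :
    (o.rename f).eval v = o.eval (v ∘ f) := by
  cases o <;> rfl

lemma eval_rename {ι : Type} (P : CompTree κ ι) :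
    ∀ {ι' : Type} (f : ι → ι') (v : ι' → ℝ), (P.rename f).eval v = P.eval (v ∘ f) := by
  induction P with
  | halt out => intro ι' f v; rfl
  | step o next ih =>
    intro ι' f v
    simp only [rename, eval, ih]
    congr 1
    funext a
    cases a <;> simp [Instr.eval_rename]
  | test a pos nonpos ih₁ ih₂ =>
    intro ι' f v
    simp only [rename, eval, ih₁, ih₂, Function.comp]

lemma steps_rename {ι : Type} (P : CompTree κ ι) :
    ∀ {ι' : Type} (f : ι → ι'), (P.rename f).steps = P.steps := by
  induction P with
  | halt out => intro ι' f; rfl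
  | step o next ih => intro ι' f; simp only [rename, steps, ih]
  | test a pos nonpos ih₁ ih₂ => intro ι' f; simp only [rename, steps, ih₁, ih₂]

lemma eval_andThen {ι : Type} (P : CompTree κ ι) :
    ∀ (Q : CompTree κ' (ι ⊕ κ)) (v : ι → ℝ),
      (P.andThen Q).eval v = Q.eval (Sum.elim v (P.eval v)) := by
  induction P with
  | halt out =>
    intro Q v
    simp only [andThen, eval, eval_rename]
    congr 1
    funext a
    cases a <;> rfl
  | step o next ih =>
    intro Q v
    simp only [andThen, eval, ih, eval_rename]
    congr 1
    funext a
    cases a <;> rfl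
  | test a pos nonpos ih₁ ih₂ =>
    intro Q v
    simp only [andThen, eval, ih₁, ih₂]
    split_ifs <;> rfl

/-- Every leaf of `P` is continued by the same tree up to renaming, which is free. A longest path
thus extends a longest path of `P`, and the worst cases add exactly rather than just subadditively.
-/
lemma steps_andThen {ι : Type} (P : CompTree κ ι) :
    ∀ (Q : CompTree κ' (ι ⊕ κ)), (P.andThen Q).steps = P.steps + Q.steps := by
  induction P with
  | halt out => intro Q; simp only [andThen, steps, steps_rename, zero_add]
  | step o next ih => intro Q; simp only [andThen, steps, steps_rename, ih]; omega
  | test a pos nonpos ih₁ ih₂ => intro Q; simp only [andThen, steps, ih₁, ih₂]; omega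

lemma eval_runEach {θ : Type} (Q : CompTree κ θ) (N : ℕ) :
    ∀ {ι : Type} (g : Fin N → θ → ι) (v : ι → ℝ) (τ : Fin N) (x : κ),
      (runEach Q N g).eval v (τ, x) = Q.eval (v ∘ g τ) x := by
  induction N with
  | zero => intro ι g v τ; exact τ.elim0
  | succ N ih =>
    intro ι g v τ x
    simp only [runEach, eval_andThen, eval_rename]
    refine Fin.cases ?_ (fun τ => ?_) τ
    · rfl
    · simp only [eval, Fin.cases_succ, Sum.elim_inr, ih]
      rfl

lemma steps_runEach {θ : Type} (Q : CompTree κ θ) (N : ℕ) :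
    ∀ {ι : Type} (g : Fin N → θ → ι), (runEach Q N g).steps = N * Q.steps := by
  induction N with
  | zero => intro ι g; simp [runEach, steps]
  | succ N ih => intro ι g; simp only [runEach, steps_andThen, steps_rename, ih, steps]; ring

end CompTree

/-! ### Functions and tests that trees can carry out -/

/-- Some computation tree computes the real-valued function `g`. -/
def TreeComputable {ι : Type} (g : (ι → ℝ) → ℝ) : Prop :=
  ∃ P : CompTree Unit ι, ∀ v, P.eval v () = g v

/-- Membership in the set described by `r` can be tested by a computation tree. -/
def TreeDecidable {ι : Type} (r : (ι → ℝ) → Prop) : Prop :=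
  ∀ g h : (ι → ℝ) → ℝ, TreeComputable g → TreeComputable h →
    ∃ f, TreeComputable f ∧ ∀ v, (r v → f v = g v) ∧ (¬ r v → f v = h v)

namespace TreeComputable

open CompTree

variable {ι : Type} {g h : (ι → ℝ) → ℝ}

lemma proj (a : ι) : TreeComputable fun v : ι → ℝ => v a :=
  ⟨halt fun _ => a, fun _ => rfl⟩

lemma const (c : ℝ) : TreeComputable fun _ : ι → ℝ => c :=
  ⟨step (.const c) (halt fun _ => none), fun _ => rfl⟩

lemma op (o : Instr (Unit ⊕ Unit)) (hg : TreeComputable g) (hh : TreeComputable h) :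
    TreeComputable fun v => o.eval (Sum.elim (fun _ => g v) fun _ => h v) := by
  obtain ⟨P, hP⟩ := hg
  obtain ⟨Q, hQ⟩ := hh
  refine ⟨P.andThen ((Q.rename Sum.inl).andThen
    (step (o.rename (Sum.map Sum.inr id)) (halt fun _ => none))), fun v => ?_⟩
  simp only [eval_andThen, eval_rename, eval, Instr.eval_rename, Option.elim]
  congr 1
  funext a
  rcases a with a | a
  · exact hP v
  · exact hQ v

lemma add (hg : TreeComputable g) (hh : TreeComputable h) :
    TreeComputable fun v => g v + h v := op (.add (.inl ()) (.inr ())) hg hh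

lemma sub (hg : TreeComputable g) (hh : TreeComputable h) :
    TreeComputable fun v => g v - h v := op (.sub (.inl ()) (.inr ())) hg hh

lemma mul (hg : TreeComputable g) (hh : TreeComputable h) :
    TreeComputable fun v => g v * h v := op (.mul (.inl ()) (.inr ())) hg hh

lemma div (hg : TreeComputable g) (hh : TreeComputable h) :
    TreeComputable fun v => g v / h v := op (.div (.inl ()) (.inr ())) hg hh

lemma sum {α : Type*} (s : Finset α) {g : α → (ι → ℝ) → ℝ} (hg : ∀ a ∈ s, TreeComputable (g a)) :
    TreeComputable fun v => ∑ a ∈ s, g a v := by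
  classical
  induction s using Finset.induction_on with
  | empty => simpa using const 0
  | insert a s ha ih =>
    simp only [Finset.sum_insert ha]
    exact (hg a (by simp)).add (ih fun b hb => hg b (by simp [hb]))

lemma prod {α : Type*} (s : Finset α) {g : α → (ι → ℝ) → ℝ}
    (hg : ∀ a ∈ s, TreeComputable (g a)) : TreeComputable fun v => ∏ a ∈ s, g a v := by
  classical
  induction s using Finset.induction_on with
  | empty => simpa using const 1
  | insert a s ha ih =>
    simp only [Finset.prod_insert ha]
    exact (hg a (by simp)).mul (ih fun b hb => hg b (by simp [hb]))

lemma ite {r : (ι → ℝ) → Prop} [DecidablePred r] (hr : TreeDecidable r) (hg : TreeComputable g)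
    (hh : TreeComputable h) : TreeComputable fun v => if r v then g v else h v := by
  obtain ⟨f, hf, hfv⟩ := hr g h hg hh
  convert hf using 2 with v
  by_cases hv : r v
  · simp [hv, (hfv v).1 hv]
  · simp [hv, (hfv v).2 hv]

/-- Finitely many computable functions can be computed together. -/
lemma exists_tree {κ : Type} [Finite κ] {g : κ → (ι → ℝ) → ℝ} (hg : ∀ x, TreeComputable (g x)) :
    ∃ P : CompTree κ ι, ∀ v x, P.eval v x = g x v := by
  induction κ using Finite.induction_empty_option with
  | of_equiv e ih =>
    obtain ⟨P, hP⟩ := ih (g := fun x => g (e x)) fun x => hg _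
    refine ⟨P.andThen (halt fun x => Sum.inr (e.symm x)), fun v x => ?_⟩
    simp [eval_andThen, eval, hP]
  | h_empty => exact ⟨halt PEmpty.elim, fun v x => x.elim⟩
  | h_option ih =>
    obtain ⟨P, hP⟩ := ih (g := fun x => g (some x)) fun x => hg _
    obtain ⟨Q, hQ⟩ := hg none
    refine ⟨P.andThen ((Q.rename Sum.inl).andThen
      (halt fun x => x.elim (Sum.inr ()) fun x => Sum.inl (Sum.inr x))), fun v x => ?_⟩
    cases x
    · simpa [eval_andThen, eval, eval_rename] using hQ v
    · simp [eval_andThen, eval, hP]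

end TreeComputable

namespace TreeDecidable

open CompTree

variable {ι : Type} {g h : (ι → ℝ) → ℝ} {r s : (ι → ℝ) → Prop}

/-- Since decidability is phrased as the ability to branch between any two computable functions,
negation swaps the branches and conjunction nests them. The sign test is the only primitive case. -/
lemma pos (hg : TreeComputable g) : TreeDecidable fun v => 0 < g v := by
  rintro f₁ f₂ ⟨P, hP⟩ ⟨Q, hQ⟩
  obtain ⟨R, hR⟩ := hg
  refine ⟨_, ⟨R.andThen (test (Sum.inr ()) (P.rename Sum.inl) (Q.rename Sum.inl)),
    fun v => rfl⟩, fun v => ?_⟩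
  simp only [eval_andThen, eval, eval_rename, Sum.elim_inr, hR]
  constructor <;> intro hv <;> simp [hv, Sum.elim_comp_inl, hP, hQ]

lemma not (hr : TreeDecidable r) : TreeDecidable fun v => ¬ r v := by
  intro f₁ f₂ h₁ h₂
  obtain ⟨f, hf, hfv⟩ := hr f₂ f₁ h₂ h₁
  exact ⟨f, hf, fun v => ⟨(hfv v).2, fun hv => (hfv v).1 (not_not.1 hv)⟩⟩

lemma and (hr : TreeDecidable r) (hs : TreeDecidable s) : TreeDecidable fun v => r v ∧ s v := by
  intro f₁ f₂ h₁ h₂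
  obtain ⟨f, hf, hfv⟩ := hr f₁ f₂ h₁ h₂
  obtain ⟨f', hf', hfv'⟩ := hs f f₂ hf h₂
  refine ⟨f', hf', fun v => ?_⟩
  have := hfv v
  have := hfv' v
  by_cases hrv : r v <;> by_cases hsv : s v <;> simp_all

lemma or (hr : TreeDecidable r) (hs : TreeDecidable s) : TreeDecidable fun v => r v ∨ s v := by
  convert (hr.not.and hs.not).not using 2
  tauto

lemma lt (hg : TreeComputable g) (hh : TreeComputable h) : TreeDecidable fun v => g v < h v := by
  simpa using pos (hh.sub hg)

lemma eq (hg : TreeComputable g) (hh : TreeComputable h) : TreeDecidable fun v => g v = h v := by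
  convert (lt hg hh).not.and (lt hh hg).not using 2
  simp only [not_lt, le_antisymm_iff, and_comm]

lemma forall_mem {α : Type*} (t : Finset α) {r : α → (ι → ℝ) → Prop}
    (hr : ∀ a ∈ t, TreeDecidable (r a)) : TreeDecidable fun v => ∀ a ∈ t, r a v := by
  classical
  induction t using Finset.induction_on with
  | empty => exact fun f₁ _ h₁ _ => ⟨f₁, h₁, fun v => by simp⟩
  | insert a t ha ih =>
    simp only [Finset.forall_mem_insert]
    exact (hr a (by simp)).and (ih fun b hb => hr b (by simp [hb]))

end TreeDecidable

lemma TreeComputable.abs {ι : Type} {g : (ι → ℝ) → ℝ} (hg : TreeComputable g) :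
    TreeComputable fun v => |g v| := by
  classical
  convert (TreeComputable.ite (TreeDecidable.pos hg) hg ((TreeComputable.const 0).sub hg)) using 2
    with v
  split_ifs with hv
  · exact abs_of_pos hv
  · simpa using abs_of_nonpos (not_lt.1 hv)

/-- A function of finitely many inputs is computed by some tree. -/
lemma exists_tree_of_finite {ι κ Z : Type} [Finite ι] [Finite κ] [Finite Z] (inp : Z → ι → ℝ)
    (hinp : Function.Injective inp) (f : Z → κ → ℝ) :
    ∃ P : CompTree κ ι, ∀ z, P.eval (inp z) = f z := by
  classical
  have := Fintype.ofFinite ι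
  have := Fintype.ofFinite Z
  -- A lookup table, written as a sum over all inputs `z` of an indicator times the value;
  -- injectivity of `inp` leaves one non-zero term.
  obtain ⟨P, hP⟩ := TreeComputable.exists_tree
    (g := fun x (v : ι → ℝ) => ∑ z : Z, if ∀ a ∈ Finset.univ, v a = inp z a then f z x else 0)
    (fun x => TreeComputable.sum _ fun z _ => TreeComputable.ite
      (TreeDecidable.forall_mem _ fun a _ => TreeDecidable.eq (.proj a) (.const _))
      (.const _) (.const _))
  refine ⟨P, fun z => funext fun x => ?_⟩
  rw [hP, Finset.sum_eq_single z]
  · simp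
  · intro z' _ hz'
    rw [if_neg]
    exact fun h => hz' (hinp (funext fun a => (h a (Finset.mem_univ _)).symm))
  · simp

/-- A linear search that carries the best candidate so far and its cost `d`, so that the next
candidate can be compared without knowing which index won. -/
lemma TreeComputable.exists_argmin {ι κ α : Type} (s : Finset α) {c : α → κ → (ι → ℝ) → ℝ}
    {r : α → (ι → ℝ) → Prop} {cost : α → (ι → ℝ) → ℝ} (hc : ∀ a x, TreeComputable (c a x))
    (hr : ∀ a, TreeDecidable (r a)) (hcost : ∀ a, TreeComputable (cost a)) :
    ∃ (g : κ → (ι → ℝ) → ℝ) (d : (ι → ℝ) → ℝ), (∀ x, TreeComputable (g x)) ∧ TreeComputable d ∧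
      ∀ v, (∃ a ∈ s, r a v) → ∃ a ∈ s, r a v ∧ (∀ x, g x v = c a x v) ∧ d v = cost a v ∧
        ∀ b ∈ s, r b v → cost a v ≤ cost b v := by
  classical
  induction s using Finset.induction_on with
  | empty =>
    exact ⟨fun _ _ => 0, fun _ => 0, fun _ => .const 0, .const 0, fun v ⟨a, ha, _⟩ => by simp at ha⟩
  | insert a s ha ih =>
    obtain ⟨g, d, hg, hd, hgd⟩ := ih
    -- As long as no candidate has been feasible, `d` is meaningless; this case is tested
    -- separately.
    let better : (ι → ℝ) → Prop := fun v => r a v ∧ ((∀ b ∈ s, ¬ r b v) ∨ cost a v < d v)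
    have hbetter : TreeDecidable better :=
      (hr a).and ((TreeDecidable.forall_mem _ fun b _ => (hr b).not).or
        (TreeDecidable.lt (hcost a) hd))
    refine ⟨fun x v => if better v then c a x v else g x v,
      fun v => if better v then cost a v else d v,
      fun x => .ite hbetter (hc a x) (hg x), .ite hbetter (hcost a) hd, fun v hv => ?_⟩
    by_cases hb : better v
    · refine ⟨a, by simp, hb.1, by simp [hb], by simp [hb], fun b hbs hrb => ?_⟩
      rcases Finset.mem_insert.1 hbs with rfl | hbs
      · exact le_rfl
      · obtain ⟨a', ha', -, -, hda', hmin⟩ := hgd v ⟨b, hbs, hrb⟩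
        rcases hb.2 with h | h
        · exact absurd hrb (h b hbs)
        · exact (h.le.trans hda'.le).trans (hmin b hbs hrb)
    · have hex : ∃ b ∈ s, r b v := by
        obtain ⟨b, hbs, hrb⟩ := hv
        rcases Finset.mem_insert.1 hbs with rfl | hbs
        · by_contra hne
          push Not at hne
          exact hb ⟨hrb, Or.inl hne⟩
        · exact ⟨b, hbs, hrb⟩
      obtain ⟨a', ha', hra', hga', hda', hmin⟩ := hgd v hex
      refine ⟨a', by simp [ha'], hra', by simpa [hb] using hga', by simpa [hb] using hda',
        fun b hbs hrb => ?_⟩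
      rcases Finset.mem_insert.1 hbs with rfl | hbs
      · by_contra hlt
        exact hb ⟨hrb, Or.inr (by rw [hda']; exact not_le.1 hlt)⟩
      · exact hmin b hbs hrb

/-! ### Determinants and inverses by trees -/

section Matrices

variable {ι : Type} {α β : Type} [Fintype α] [DecidableEq α] [Fintype β]

lemma TreeComputable.det {M : Matrix α α ((ι → ℝ) → ℝ)} (hM : ∀ a b, TreeComputable (M a b)) :
    TreeComputable fun v => Matrix.det (Matrix.of fun a b => M a b v) := by
  simp only [Matrix.det_apply']
  exact .sum _ fun σ _ => (TreeComputable.const _).mul (.prod _ fun a _ => hM _ _)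

/-- Cramer's rule. No test for singularity is needed: the inverse of a singular matrix is zero by
convention, and so is a quotient by zero. -/
lemma TreeComputable.inv {M : Matrix α α ((ι → ℝ) → ℝ)} (hM : ∀ a b, TreeComputable (M a b))
    (a b : α) : TreeComputable fun v => (Matrix.of fun a b => M a b v)⁻¹ a b := by
  have h : ∀ v, (Matrix.of fun a b => M a b v)⁻¹ a b =
      (Matrix.of fun a' b' => (if a' = b then if b' = a then 1 else 0 else M a' b' v)).det /
        (Matrix.of fun a b => M a b v).det := by
    intro v
    rw [Matrix.inv_def, Matrix.smul_apply, Ring.inverse_eq_inv', smul_eq_mul, div_eq_inv_mul,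
      Matrix.adjugate_apply]
    congr 2
    ext a' b'
    by_cases hab : a' = b <;> simp [Matrix.updateRow_apply, hab, Pi.single_apply]
  simp only [h]
  refine .div (.det (M := fun a' b' v => if a' = b then if b' = a then 1 else 0 else M a' b' v)
    fun a' b' => ?_) (.det hM)
  by_cases h₁ : a' = b <;> by_cases h₂ : b' = a <;> simp [h₁, h₂, hM, TreeComputable.const]

end Matrices

/-! ### `L¹` minimization by enumeration of supports -/

section BasicSolutions

variable {m n : ℕ}

/-- The columns of `A` with indices in `J`. -/
def colsOn (A : Matrix (Fin m) (Fin n) ℝ) (J : Finset (Fin n)) : Matrix (Fin m) J ℝ :=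
  A.submatrix id Subtype.val

/-- Least squares solution of `A x = y` among the vectors supported on `J`, if the columns in `J`
are linearly independent. -/
noncomputable def basicSolution (A : Matrix (Fin m) (Fin n) ℝ) (y : Fin m → ℝ) (J : Finset (Fin n))
    (i : Fin n) : ℝ :=
  if h : i ∈ J then
    (((colsOn A J).transpose * colsOn A J)⁻¹.mulVec ((colsOn A J).transpose.mulVec y)) ⟨i, h⟩
  else 0

/-- Independence of the columns makes the Gram matrix invertible, because it has the same kernel as
the columns; the normal equations then return `x`. -/
lemma basicSolution_eq {A : Matrix (Fin m) (Fin n) ℝ} {x : Fin n → ℝ} {J : Finset (Fin n)}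
    (hJ : ∀ i, i ∉ J → x i = 0)
    (hind : ∀ u : Fin n → ℝ, (∀ i, i ∉ J → u i = 0) → A.mulVec u = 0 → u = 0) :
    basicSolution A (A.mulVec x) J = x := by
  have hcols : ∀ u : Fin n → ℝ, (∀ i, i ∉ J → u i = 0) →
      (colsOn A J).mulVec (fun i => u i) = A.mulVec u := by
    intro u hu
    ext a
    simp only [Matrix.mulVec, dotProduct, colsOn, Matrix.submatrix_apply, id]
    rw [Finset.sum_coe_sort J fun i => A a i * u i]
    exact Finset.sum_subset (Finset.subset_univ _) fun i _ hi => by simp [hu i hi]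
  have hunit : IsUnit ((colsOn A J).transpose * colsOn A J) := by
    rw [← Matrix.mulVec_injective_iff_isUnit, ← Matrix.coe_mulVecLin,
      ← LinearMap.ker_eq_bot, Matrix.ker_mulVecLin_transpose_mul_self, LinearMap.ker_eq_bot']
    intro c hc
    have h0 := hind (fun i => if h : i ∈ J then c ⟨i, h⟩ else 0) (fun i hi => by simp [hi]) (by
      rw [← hcols _ (fun i hi => by simp [hi])]
      simpa using hc)
    ext i
    simpa using congrFun h0 i.1
  ext i
  unfold basicSolution
  split_ifs with hi
  · rw [← hcols x hJ, Matrix.mulVec_mulVec, Matrix.mulVec_mulVec, Matrix.mul_assoc,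
      Matrix.nonsing_inv_mul _
      ((Matrix.isUnit_iff_isUnit_det _).1 hunit), Matrix.one_mulVec]
  · exact (hJ i hi).symm

/-- If the columns in the support of `x` are dependent, then some coordinate of `x` can be
eliminated without increasing the `L¹` norm. -/
lemma exists_smaller_support {A : Matrix (Fin m) (Fin n) ℝ} {x u : Fin n → ℝ}
    (hu : ∀ i, x i = 0 → u i = 0) (hAu : A.mulVec u = 0) (hu0 : u ≠ 0) :
    ∃ x' : Fin n → ℝ, A.mulVec x' = A.mulVec x ∧ ∑ i, |x' i| ≤ ∑ i, |x i| ∧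
      Finset.univ.filter (fun i => x' i ≠ 0) ⊂ Finset.univ.filter (fun i => x i ≠ 0) := by
  -- The sum is the derivative of the `L¹` norm at `x` along `u`; replacing `u` by `-u` makes it
  -- non-positive.
  wlog hs : ∑ i, SignType.sign (x i) * u i ≤ 0 generalizing u
  · refine this (u := -u) (fun i hi => by simp [hu i hi]) (by simp [Matrix.mulVec_neg, hAu])
      (by simpa using hu0) ?_
    simp only [Pi.neg_apply, mul_neg, Finset.sum_neg_distrib]
    linarith
  -- The coordinates that move towards zero along `u`. If there were none, all terms of the
  -- non-positive sum would be non-negative, which forces `u = 0`.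
  set I := Finset.univ.filter fun i => x i * u i < 0 with hI
  have hIne : I.Nonempty := by
    by_contra hne
    rw [Finset.not_nonempty_iff_eq_empty, Finset.filter_eq_empty_iff] at hne
    have hnn : ∀ i ∈ Finset.univ, 0 ≤ (SignType.sign (x i) : ℝ) * u i := by
      intro i hi
      have := hne hi
      push Not at this
      rcases lt_trichotomy (x i) 0 with h | h | h
      · simp [sign_neg h]; nlinarith
      · simp [h]
      · simp [sign_pos h]; nlinarith
    have h0 := (Finset.sum_eq_zero_iff_of_nonneg hnn).1 (le_antisymm hs (Finset.sum_nonneg hnn))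
    refine hu0 (funext fun i => ?_)
    by_cases hxi : x i = 0
    · exact hu i hxi
    · rcases mul_eq_zero.1 (h0 i (Finset.mem_univ i)) with h | h
      · rcases lt_or_gt_of_ne hxi with h' | h'
        · simp [sign_neg h'] at h
        · simp [sign_pos h'] at h
      · exact h
  -- The coordinate `i₀` reaches zero first, at time `t`. No coordinate has changed sign by then, so
  -- the norm is linear on the way.
  obtain ⟨i₀, hi₀, hmin⟩ := I.exists_min_image (fun i => -(x i / u i)) hIne
  have hlt : x i₀ * u i₀ < 0 := (Finset.mem_filter.1 hi₀).2
  have hu₀ : u i₀ ≠ 0 := by rintro h; simp [h] at hlt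
  have hx₀ : x i₀ ≠ 0 := by rintro h; simp [h] at hlt
  set t := -(x i₀ / u i₀) with ht
  have htpos : 0 < t := by
    have : t = -(x i₀ * u i₀) / (u i₀) ^ 2 := by rw [ht]; field_simp
    rw [this]
    have := sq_pos_of_ne_zero hu₀
    apply div_pos <;> linarith
  have habs : ∀ i, |x i + t * u i| = SignType.sign (x i) * (x i + t * u i) := by
    intro i
    rcases lt_trichotomy (x i) 0 with h | h | h
    · rw [sign_neg h, abs_of_nonpos]
      · simp
      · by_cases hui : 0 < u i
        · have := hmin i (by simp [hI]; nlinarith)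
          have h2 : t * u i ≤ -(x i / u i) * u i := mul_le_mul_of_nonneg_right this hui.le
          have h3 : x i / u i * u i = x i := div_mul_cancel₀ _ hui.ne'
          linarith
        · nlinarith
    · simp [h, hu i h]
    · rw [sign_pos h, abs_of_nonneg]
      · simp
      · by_cases hui : u i < 0
        · have := hmin i (by simp [hI]; nlinarith)
          have h2 : -(x i / u i) * u i ≤ t * u i := mul_le_mul_of_nonpos_right this hui.le
          have h3 : x i / u i * u i = x i := div_mul_cancel₀ _ hui.ne
          linarith
        · nlinarith
  refine ⟨fun i => x i + t * u i, ?_, ?_, ?_⟩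
  · have : (fun i => x i + t * u i) = x + t • u := by ext; simp
    rw [this, Matrix.mulVec_add, Matrix.mulVec_smul, hAu]
    simp
  · have hx : ∀ i, |x i| = SignType.sign (x i) * x i := fun i => (sign_mul_self (x i)).symm
    simp only [habs, hx, mul_add, Finset.sum_add_distrib]
    have : ∑ i, (SignType.sign (x i) : ℝ) * (t * u i) = t * ∑ i, SignType.sign (x i) * u i := by
      rw [Finset.mul_sum]; exact Finset.sum_congr rfl fun i _ => by ring
    rw [this]
    nlinarith
  · rw [Finset.ssubset_iff_of_subset]
    · refine ⟨i₀, by simpa using hx₀, ?_⟩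
      have : x i₀ + t * u i₀ = 0 := by rw [ht]; field_simp; ring
      simpa using this
    · intro i hi
      simp only [Finset.mem_filter, Finset.mem_univ, true_and] at hi ⊢
      intro h
      exact hi (by simp [h, hu i h])

/-- Supports shrink by `exists_smaller_support` until their columns are independent; the vector is
then the basic solution of its own support. Thus the finitely many basic solutions contain a
minimizer. -/
lemma exists_basicSolution (A : Matrix (Fin m) (Fin n) ℝ) (x : Fin n → ℝ) :
    ∃ J, A.mulVec (basicSolution A (A.mulVec x) J) = A.mulVec x ∧
      ∑ i, |basicSolution A (A.mulVec x) J i| ≤ ∑ i, |x i| := by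
  induction hs : Finset.univ.filter (fun i => x i ≠ 0) using Finset.strongInduction
    generalizing x with
  | H s ih =>
    by_cases hdep : ∃ u : Fin n → ℝ, (∀ i, x i = 0 → u i = 0) ∧ A.mulVec u = 0 ∧ u ≠ 0
    · obtain ⟨u, hu, hAu, hu0⟩ := hdep
      obtain ⟨x', hx', hle, hss⟩ := exists_smaller_support hu hAu hu0
      obtain ⟨J, h₁, h₂⟩ := ih _ (hs ▸ hss) x' rfl
      rw [hx'] at h₁ h₂
      exact ⟨J, h₁, h₂.trans hle⟩
    · push Not at hdep
      refine ⟨s, ?_⟩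
      rw [basicSolution_eq]
      · exact ⟨rfl, le_rfl⟩
      · intro i hi; simpa [← hs] using hi
      · intro u hu
        exact hdep u fun i hi => hu i (by simp [← hs, hi])

/-- `L¹` minimization can be carried out by a computation tree. -/
theorem exists_solvesL1 (m n : ℕ) :
    ∃ Q : CompTree (Fin n) ((Fin m × Fin n) ⊕ Fin m), SolvesL1 Q := by
  let A : ((Fin m × Fin n) ⊕ Fin m → ℝ) → Matrix (Fin m) (Fin n) ℝ :=
    fun v => Matrix.of fun a b => v (Sum.inl (a, b))
  let y : ((Fin m × Fin n) ⊕ Fin m → ℝ) → Fin m → ℝ := fun v a => v (Sum.inr a)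
  have hbasic : ∀ J i, TreeComputable fun v => basicSolution (A v) (y v) J i := by
    intro J i
    unfold basicSolution
    split_ifs with hi
    · refine .sum _ fun j _ => .mul (.inv (M := fun a b v => ((colsOn (A v) J).transpose *
        colsOn (A v) J) a b) (fun a b => ?_) _ _) ?_
      · simp only [Matrix.mul_apply]
        exact .sum _ fun l _ => .mul (.proj _) (.proj _)
      · simp only [Matrix.mulVec, dotProduct]
        exact .sum _ fun l _ => .mul (.proj _) (.proj _)
    · exact .const 0
  -- All supports `J` are tried. Feasibility has to be tested, as a least squares candidate need not
  -- solve the system and a singular Gram matrix gives a meaningless one.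
  obtain ⟨g, d, hg, -, hmin⟩ := TreeComputable.exists_argmin
    (Finset.univ : Finset (Finset (Fin n)))
    (c := fun J i v => basicSolution (A v) (y v) J i)
    (r := fun J v => ∀ j ∈ Finset.univ, (A v).mulVec (basicSolution (A v) (y v) J) j = y v j)
    (cost := fun J v => ∑ i, |basicSolution (A v) (y v) J i|) hbasic
    (fun J => TreeDecidable.forall_mem _ fun j _ => TreeDecidable.eq (by
      simp only [Matrix.mulVec, dotProduct]
      exact .sum _ fun i _ => .mul (.proj _) (hbasic J i)) (.proj _))
    (fun J => .sum _ fun i _ => (hbasic J i).abs)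
  obtain ⟨Q, hQ⟩ := TreeComputable.exists_tree hg
  refine ⟨Q, fun A' y' ⟨x, hx⟩ => ?_⟩
  set v : (Fin m × Fin n) ⊕ Fin m → ℝ := Sum.elim (fun a => A' a.1 a.2) y' with hv
  have hA : A v = A' := by ext; simp [A, hv]
  have hy : y v = y' := by ext; simp [y, hv]
  have hfeas : ∀ z, A'.mulVec z = y' → ∃ J, A'.mulVec (basicSolution A' y' J) = y' ∧
      ∑ i, |basicSolution A' y' J i| ≤ ∑ i, |z i| := by
    rintro z rfl
    exact exists_basicSolution A' z
  obtain ⟨J₀, hJ₀, -⟩ := hfeas x hx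
  have hminv := hmin v
  rw [hA, hy] at hminv
  obtain ⟨J, -, hJ, hgJ, -, hJmin⟩ := hminv ⟨J₀, by simp, fun j _ => congrFun hJ₀ j⟩
  have hQJ : Q.eval v = basicSolution A' y' J := funext fun i => (hQ v i).trans (hgJ i)
  rw [hQJ]
  refine ⟨funext fun j => hJ j (by simp), fun z hz => ?_⟩
  obtain ⟨J', hJ', hle⟩ := hfeas z hz
  exact (hJmin J' (by simp) fun j _ => congrFun hJ' j).trans hle

end BasicSolutions

/-! ### Complexity of modular decoders -/

namespace SDCICCode

variable {V E : Type*} {n T m N : ℕ} {G : Network V E n T} {act : Fin m ↪ Fin n}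

/-- The received symbols take finitely many values and `label` is injective, so a table decodes.
Without existence, the infimum in `ncComplexity` would be the default value `0`. -/
lemma exists_computesDec (C : SDCICCode G act N) (t : Fin T) : ∃ P, C.ComputesDec t P := by
  obtain ⟨P, hP⟩ := exists_tree_of_finite (fun (z : C.Received t → C.F) a => C.label (z a))
    (fun z z' h => funext fun a => C.label.injective (congrFun h a))
    (fun z (a : Fin N × Fin m) => C.dec t z a.1 a.2)
  exact ⟨P, hP⟩

lemma Decoder.complexity_eq {C : SDCICCode G act N} {t : Fin T} (hN : 0 < N) (D : C.Decoder t) :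
    D.complexity = (D.net.steps : ℝ) / N + D.cs.steps := by
  have : (N : ℝ) ≠ 0 := by positivity
  simp only [Decoder.complexity, Decoder.program, CompTree.steps_andThen, CompTree.steps_rename,
    CompTree.steps_runEach]
  push_cast
  field_simp

/-- The least complexity of a modular decoder. -/
theorem isLeast_complexity (hN : 0 < N) (C : SDCICCode G act N) (t : Fin T) :
    IsLeast (Set.range fun D : C.Decoder t => D.complexity)
      (C.ncComplexity t + csComplexity m n) := by
  obtain ⟨P, hP⟩ := C.exists_computesDec t
  obtain ⟨Q, hQ⟩ := exists_solvesL1 m n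
  constructor
  · obtain ⟨P', hP', hPs⟩ := Nat.sInf_mem (s := {d | ∃ P, C.ComputesDec t P ∧ P.steps = d})
      ⟨_, P, hP, rfl⟩
    obtain ⟨Q', hQ', hQs⟩ := Nat.sInf_mem
      (s := {d | ∃ Q : CompTree (Fin n) ((Fin m × Fin n) ⊕ Fin m), SolvesL1 Q ∧ Q.steps = d})
      ⟨_, Q, hQ, rfl⟩
    refine ⟨⟨P', hP', Q', hQ'⟩, ?_⟩
    simp only [Decoder.complexity_eq hN, ncComplexity, csComplexity, hPs, hQs]
  · rintro _ ⟨D, rfl⟩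
    simp only [Decoder.complexity_eq hN, ncComplexity, csComplexity]
    gcongr
    · exact Nat.sInf_le ⟨_, D.net_correct, rfl⟩
    · exact Nat.sInf_le ⟨_, D.cs_correct, rfl⟩

lemma Decoder.output_eq {C : SDCICCode G act N} {t : Fin T} (D : C.Decoder t)
    (Φ : Matrix (Fin n) (Fin n) ℝ) (x : Fin N → Fin n → ℝ) (τ : Fin N) :
    D.output Φ x τ = D.cs.eval (Sum.elim (fun a => activeRows Φ act a.1 a.2)
      (C.dec t (C.receivedFrom t fun τ' j => x τ' (act j)) τ)) := by
  funext i
  simp only [Decoder.output, Decoder.program, CompTree.eval_andThen, CompTree.eval_runEach,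
    CompTree.eval_rename]
  congr 1
  funext a
  rcases a with a | j
  · rfl
  · exact congrFun (D.net_correct (C.receivedFrom t fun τ' j => x τ' (act j))) (τ, j)

end SDCICCode

/-! ### Discrete product laws -/

section ProductMass

lemma ENNReal.tsum_pi_prod {ι α : Type*} [Fintype ι] (g : ι → α → ℝ≥0∞) :
    ∑' x : ι → α, ∏ i, g i (x i) = ∏ i, ∑' a, g i a := by
  revert g
  refine Fintype.induction_empty_option (P := fun ι _ => ∀ g : ι → α → ℝ≥0∞,
    ∑' x : ι → α, ∏ i, g i (x i) = ∏ i, ∑' a, g i a) ?_ ?_ ?_ ι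
  · intro ι κ _ e ih g
    have hι := Fintype.ofEquiv _ e.symm
    rw [← e.prod_comp fun i => ∑' a, g i a]
    refine Eq.trans ?_ ((ih fun i => g (e i)).trans (by congr!))
    rw [← (e.arrowCongr (Equiv.refl α)).tsum_eq]
    refine tsum_congr fun x => ?_
    rw [← e.prod_comp]
    simp only [Equiv.arrowCongr_apply, Equiv.coe_refl, Function.comp, id, e.symm_apply_apply]
    congr!
  · simp
  · intro ι _ ih g
    rw [Fintype.prod_option, ← ih fun i => g (some i),
      ← (Equiv.piOptionEquivProd (β := fun _ => α)).symm.tsum_eq,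
      ENNReal.tsum_prod', ← ENNReal.tsum_mul_right]
    refine tsum_congr fun a => ?_
    rw [← ENNReal.tsum_mul_left]
    refine tsum_congr fun x => ?_
    rw [Fintype.prod_option]
    rfl

variable {α : Type*}

lemma massOf_mono {w : α → ℝ≥0∞} {A B : Set α} (h : ∀ x ∈ A, w x ≠ 0 → x ∈ B) :
    massOf w A ≤ massOf w B := by
  refine ENNReal.tsum_le_tsum fun x => ?_
  by_cases hx : x ∈ A
  · by_cases hw : w x = 0
    · simp [Set.indicator_of_mem hx, hw]
    · simp [Set.indicator_of_mem hx, Set.indicator_of_mem (h x hx hw)]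
  · simp [Set.indicator_of_notMem hx]

lemma massOf_iUnion_le {ι : Type*} [Fintype ι] (w : α → ℝ≥0∞) (B : ι → Set α) :
    massOf w (⋃ i, B i) ≤ ∑ i, massOf w (B i) := by
  unfold massOf
  rw [← Summable.tsum_finsetSum fun _ _ => ENNReal.summable]
  refine ENNReal.tsum_le_tsum fun x => ?_
  by_cases hx : x ∈ ⋃ i, B i
  · obtain ⟨i, hi⟩ := Set.mem_iUnion.1 hx
    rw [Set.indicator_of_mem hx]
    refine le_trans ?_ (Finset.single_le_sum (fun _ _ => zero_le) (Finset.mem_univ i))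
    rw [Set.indicator_of_mem hi]
  · simp [Set.indicator_of_notMem hx]

/-- Mass function of `N` independent draws. -/
noncomputable def iidMass (q : PMF α) (N : ℕ) (x : Fin N → α) : ℝ≥0∞ := ∏ τ, q (x τ)

lemma tsum_iidMass (q : PMF α) (N : ℕ) : ∑' x, iidMass q N x = 1 := by
  simp [iidMass, ENNReal.tsum_pi_prod fun (_ : Fin N) a => q a, q.tsum_coe]

/-- The product mass of a block of images is the total mass of its fibre, by expanding the product
of sums. This transfers bounds for one source to the joint source, whatever the correlation. -/
lemma iidMass_map {β : Type*} (q : PMF α) (f : α → β) (N : ℕ) (B : Set (Fin N → β)) :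
    massOf (iidMass q N) {x | (fun τ => f (x τ)) ∈ B} = massOf (iidMass (q.map f) N) B := by
  classical
  have h : ∀ y, iidMass (q.map f) N y =
      ∑' x : Fin N → α, if y = fun τ => f (x τ) then iidMass q N x else 0 := by
    intro y
    simp only [iidMass, PMF.map_apply]
    rw [← ENNReal.tsum_pi_prod fun (τ : Fin N) a => if y τ = f a then q a else 0]
    refine tsum_congr fun x => ?_
    rw [Finset.prod_ite_zero]
    simp [funext_iff]
  have h' : ∀ y, B.indicator (iidMass (q.map f) N) y =
      ∑' x : Fin N → α, if y = fun τ => f (x τ) then B.indicator (fun _ => iidMass q N x) y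
        else 0 := by
    intro y
    by_cases hy : y ∈ B <;> simp [hy, h]
  rw [massOf, massOf, tsum_congr h', ENNReal.tsum_comm]
  refine tsum_congr fun x => ?_
  rw [tsum_eq_single fun τ => f (x τ)]
  · simp [Set.indicator_apply]
  · intro y hy
    simp [hy]

/-- The product of finitely many discrete laws. -/
noncomputable def indepPMF {ι : Type*} [Fintype ι] (q : ι → PMF α) : PMF (ι → α) :=
  ⟨fun y => ∏ j, q j (y j), by
    convert ENNReal.summable.hasSum
    simp [ENNReal.tsum_pi_prod fun j a => q j a, PMF.tsum_coe]⟩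

lemma indepPMF_apply {ι : Type*} [Fintype ι] (q : ι → PMF α) (y : ι → α) :
    indepPMF q y = ∏ j, q j (y j) := rfl

lemma indepPMF_map_eval {ι : Type*} [Fintype ι] [DecidableEq ι] (q : ι → PMF α) (i : ι) :
    (indepPMF q).map (fun y => y i) = q i := by
  classical
  ext a
  have : ∀ y : ι → α, (if a = y i then indepPMF q y else 0) =
      ∏ j, if j = i then (if a = y j then q j (y j) else 0) else q j (y j) := by
    intro y
    rw [indepPMF_apply, ← Finset.mul_prod_erase _ _ (Finset.mem_univ i),
      ← Finset.mul_prod_erase (a := i) _ _ (Finset.mem_univ i), if_pos rfl, ite_mul, zero_mul]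
    congr 2
    exact Finset.prod_congr rfl fun j hj => (if_neg (Finset.ne_of_mem_erase hj)).symm
  rw [PMF.map_apply, tsum_congr this, ENNReal.tsum_pi_prod
    fun j b => if j = i then (if a = b then q j b else 0) else q j b,
    ← Finset.mul_prod_erase _ _ (Finset.mem_univ i), Finset.prod_eq_one]
  · simp
  · intro j hj
    simp [Finset.ne_of_mem_erase hj, PMF.tsum_coe]

end ProductMass

/-! ### Typical blocks and source coding -/

section AsymptoticEquipartition

open MeasureTheory ProbabilityTheory Filter Topology

variable {α : Type*}

/-- Entropy in nats. -/
noncomputable def natEntropy (q : PMF α) : ℝ := ∑' a, Real.negMulLog (q a).toReal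

/-- The information content of the value `a`, in nats. -/
noncomputable def infoContent (q : PMF α) (a : α) : ℝ := -Real.log (q a).toReal

lemma infoContent_nonneg (q : PMF α) (a : α) : 0 ≤ infoContent q a :=
  neg_nonneg.2 (Real.log_nonpos ENNReal.toReal_nonneg
    (by simpa using ENNReal.toReal_mono ENNReal.one_ne_top (q.coe_le_one a)))

lemma natEntropy_nonneg (q : PMF α) : 0 ≤ natEntropy q :=
  tsum_nonneg fun a => Real.negMulLog_nonneg ENNReal.toReal_nonneg
    (by simpa using ENNReal.toReal_mono ENNReal.one_ne_top (q.coe_le_one a))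

lemma integrable_infoContent [MeasurableSpace α] [DiscreteMeasurableSpace α] {q : PMF α}
    (hq : FiniteEntropy q) : Integrable (infoContent q) q.toMeasure := by
  refine ⟨(Measurable.of_discrete).aestronglyMeasurable, ?_⟩
  -- The alphabet may be uncountable; the integral becomes a sum only after restriction to the
  -- countable support.
  rw [HasFiniteIntegral, ← PMF.restrict_toMeasure_support q,
    lintegral_countable _ q.support_countable]
  have h : ∀ a : q.support, ‖infoContent q a‖ₑ * q.toMeasure {(a : α)} =
      ENNReal.ofReal (Real.negMulLog (q a).toReal) := by
    intro a
    rw [PMF.toMeasure_apply_singleton _ _ (MeasurableSet.singleton _),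
      Real.enorm_of_nonneg (infoContent_nonneg q a), ← ENNReal.ofReal_toReal (q.apply_ne_top a),
      ← ENNReal.ofReal_mul (infoContent_nonneg q a), infoContent, Real.negMulLog,
      ENNReal.toReal_ofReal ENNReal.toReal_nonneg]
    congr 1
    ring
  simp only [h]
  rw [← ENNReal.ofReal_tsum_of_nonneg]
  · exact ENNReal.ofReal_lt_top
  · exact fun a => Real.negMulLog_nonneg ENNReal.toReal_nonneg
      (by simpa using ENNReal.toReal_mono ENNReal.one_ne_top (q.coe_le_one a))
  · exact Summable.subtype hq _

lemma integral_infoContent [MeasurableSpace α] [DiscreteMeasurableSpace α] {q : PMF α}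
    (hq : FiniteEntropy q) : ∫ a, infoContent q a ∂q.toMeasure = natEntropy q := by
  rw [PMF.integral_eq_tsum _ _ (integrable_infoContent hq)]
  refine tsum_congr fun a => ?_
  simp [infoContent, Real.negMulLog]

/-- The blocks whose information content per symbol differs from the entropy by at least `δ`. -/
def atypical (q : PMF α) (δ : ℝ) (N : ℕ) : Set (Fin N → α) :=
  {x | δ ≤ |(∑ τ, infoContent q (x τ)) / N - natEntropy q|}

/-- Asymptotic equipartition property. -/
theorem eventually_massOf_atypical_le {q : PMF α} (hq : FiniteEntropy q) {δ : ℝ} (hδ : 0 < δ)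
    {ε : ℝ≥0∞} (hε : 0 < ε) :
    ∀ᶠ N in atTop, massOf (iidMass q N) (atypical q δ N) ≤ ε := by
  let _ : MeasurableSpace α := ⊤
  have : DiscreteMeasurableSpace α := ⟨fun _ => trivial⟩
  let P : Measure (ℕ → α) := Measure.infinitePi fun _ => q.toMeasure
  let X : ℕ → (ℕ → α) → ℝ := fun i ω => infoContent q (ω i)
  have hf : Measurable (infoContent q) := .of_discrete
  have hX : ∀ i, Measurable (X i) := fun i => hf.comp (measurable_pi_apply i)
  have hid : ∀ i, IdentDistrib (X i) (X 0) P P := fun i =>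
    (IdentDistrib.mk (measurable_pi_apply i).aemeasurable (measurable_pi_apply 0).aemeasurable
      
      ((measurePreserving_eval_infinitePi (fun _ => q.toMeasure) i).map_eq.trans
        (measurePreserving_eval_infinitePi (fun _ => q.toMeasure) 0).map_eq.symm)).comp hf
  have hmp : MeasurePreserving (fun ω : ℕ → α => ω 0) P q.toMeasure :=
    measurePreserving_eval_infinitePi (fun _ => q.toMeasure) 0
  have hind : iIndepFun X P := iIndepFun_infinitePi (Ω := fun _ : ℕ => α)
    (P := fun _ => q.toMeasure) (X := fun _ => infoContent q) fun _ => hf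
  have hint : Integrable (X 0) P := hmp.integrable_comp_of_integrable (integrable_infoContent hq)
  have hexp : P[X 0] = natEntropy q := by
    rw [← integral_infoContent hq, ← hmp.map_eq,
      integral_map (measurable_pi_apply 0).aemeasurable hf.aestronglyMeasurable]
  have hlim := strong_law_ae_real X hint (fun i j hij => hind.indepFun hij) hid
  rw [hexp] at hlim
  have hmeas := tendstoInMeasure_of_tendsto_ae (fun N => Measurable.aestronglyMeasurable
    ((Finset.measurable_sum _ fun i _ => hX i).div_const (N : ℝ))) hlim
  rw [tendstoInMeasure_iff_norm] at hmeas
  filter_upwards [(hmeas δ hδ).eventually (ge_mem_nhds hε)] with N hN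
  refine le_trans ?_ hN
  -- The strong law concerns infinite sequences. The cylinder of a block has the mass of the block,
  -- and distinct blocks have disjoint cylinders.
  let cyl : (Fin N → α) → Set (ℕ → α) := fun x =>
    Set.pi (Finset.range N) fun i => if h : i < N then {x ⟨i, h⟩} else Set.univ
  have hcyl : ∀ x ω, ω ∈ cyl x ↔ ∀ τ : Fin N, ω τ = x τ := by
    intro x ω
    constructor
    · intro h τ
      simpa using h τ (by simp)
    · intro h i hi
      have hi' : i < N := by simpa using hi
      simpa [hi'] using h ⟨i, hi'⟩
  have hPcyl : ∀ x, P (cyl x) = iidMass q N x := by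
    intro x
    rw [Measure.infinitePi_pi (fun _ => q.toMeasure) fun _ _ => .of_discrete, iidMass,
      Finset.prod_range]
    refine Finset.prod_congr rfl fun τ _ => ?_
    rw [dif_pos τ.2, PMF.toMeasure_apply_singleton _ _ (.of_discrete)]
  have hcm : ∀ x, MeasurableSet (cyl x) := fun x =>
    .pi (Finset.countable_toSet _) fun _ _ => .of_discrete
  calc massOf (iidMass q N) (atypical q δ N)
      = ∑' x : atypical q δ N, P (cyl x) := by
        rw [massOf, ← tsum_subtype]
        exact tsum_congr fun x => (hPcyl x).symm
    -- The index set may be uncountable, but this direction holds for every disjoint family of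
    -- measurable sets.
    _ ≤ P (⋃ x : atypical q δ N, cyl x) := by
        refine tsum_meas_le_meas_iUnion_of_disjoint P (fun x => hcm x) fun x y hxy => ?_
        refine Set.disjoint_left.2 fun ω hω hω' => hxy (Subtype.ext (funext fun τ => ?_))
        rw [← (hcyl _ _).1 hω τ, ← (hcyl _ _).1 hω' τ]
    _ ≤ _ := by
        refine measure_mono (Set.iUnion_subset fun x ω hω => ?_)
        have hx := x.2
        rw [hcyl] at hω
        simp only [Set.mem_ofPred_eq, atypical, X, Finset.sum_range, Real.norm_eq_abs, hω] at hx ⊢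
        exact hx

lemma toReal_iidMass {q : PMF α} {N : ℕ} {x : Fin N → α} (hx : iidMass q N x ≠ 0) :
    (iidMass q N x).toReal = Real.exp (-∑ τ, infoContent q (x τ)) := by
  rw [iidMass, Finset.prod_ne_zero_iff] at hx
  rw [iidMass, ENNReal.toReal_prod, ← Finset.sum_neg_distrib, Real.exp_sum]
  refine Finset.prod_congr rfl fun τ hτ => ?_
  rw [infoContent, neg_neg, Real.exp_log]
  exact ENNReal.toReal_pos (hx τ hτ) (q.apply_ne_top _)

lemma iidMass_ne_top (q : PMF α) (N : ℕ) (x : Fin N → α) : iidMass q N x ≠ ∞ :=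
  ENNReal.prod_ne_top fun _ _ => q.apply_ne_top _

lemma iidMass_le_of_typical {q : PMF α} {δ : ℝ} {N : ℕ} (hN : 0 < N) {x : Fin N → α}
    (hx : x ∉ atypical q δ N) :
    iidMass q N x ≤ ENNReal.ofReal (Real.exp (-(N * (natEntropy q - δ)))) := by
  by_cases h0 : iidMass q N x = 0
  · simp [h0]
  rw [← ENNReal.ofReal_toReal (iidMass_ne_top q N x), toReal_iidMass h0]
  refine ENNReal.ofReal_le_ofReal (Real.exp_le_exp.2 (neg_le_neg ?_))
  simp only [atypical, Set.mem_ofPred_eq, not_le, abs_lt] at hx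
  have hN' : (0 : ℝ) < N := by exact_mod_cast hN
  have := hx.1
  rw [mul_comm, ← le_div_iff₀ hN']
  linarith

lemma le_iidMass_of_typical {q : PMF α} {δ : ℝ} {N : ℕ} (hN : 0 < N) {x : Fin N → α}
    (hx : x ∉ atypical q δ N) (h0 : iidMass q N x ≠ 0) :
    ENNReal.ofReal (Real.exp (-(N * (natEntropy q + δ)))) ≤ iidMass q N x := by
  rw [← ENNReal.ofReal_toReal (iidMass_ne_top q N x), toReal_iidMass h0]
  refine ENNReal.ofReal_le_ofReal (Real.exp_le_exp.2 (neg_le_neg ?_))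
  simp only [atypical, Set.mem_ofPred_eq, not_le, abs_lt] at hx
  have hN' : (0 : ℝ) < N := by exact_mod_cast hN
  have := hx.2
  rw [mul_comm (N : ℝ), ← div_le_iff₀ hN']
  linarith

/-- Vanishing of a sum of non-negative terms forces every probability to be `0` or `1`. Such a
source needs no bits at all, which matters when no edge crosses a cut. -/
lemma iidMass_eq_one_of_natEntropy_eq_zero {q : PMF α} (hq : FiniteEntropy q)
    (h : natEntropy q = 0) {N : ℕ} {x : Fin N → α} (h0 : iidMass q N x ≠ 0) :
    iidMass q N x = 1 := by
  have hz : ∀ a, Real.negMulLog (q a).toReal = 0 := by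
    have := (hasSum_zero_iff_of_nonneg (fun a => Real.negMulLog_nonneg ENNReal.toReal_nonneg
      (by simpa using ENNReal.toReal_mono ENNReal.one_ne_top (q.coe_le_one a)))).1
      (by rw [← h]; exact hq.hasSum)
    exact fun a => congrFun this a
  rw [iidMass, Finset.prod_ne_zero_iff] at h0
  refine Finset.prod_eq_one fun τ hτ => ?_
  have h1 := hz (x τ)
  have hpos := ENNReal.toReal_pos (h0 τ hτ) (q.apply_ne_top _)
  rw [Real.negMulLog, neg_mul, neg_eq_zero, mul_eq_zero, or_iff_right hpos.ne',
    Real.log_eq_zero] at h1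
  rcases h1 with h1 | h1 | h1
  · exact absurd h1 hpos.ne'
  · exact (ENNReal.toReal_eq_one_iff _).1 h1
  · linarith

/-- Noiseless source coding: for large `N`, all but a small fraction of the blocks lie in a set
whose size is given by the entropy. -/
theorem eventually_exists_typical_finset {q : PMF α} (hq : FiniteEntropy q) {δ : ℝ} (hδ : 0 < δ)
    {ε : ℝ≥0∞} (hε : 0 < ε) :
    ∀ᶠ N : ℕ in atTop, ∃ S : Finset (Fin N → α), massOf (iidMass q N) (S : Set (Fin N → α))ᶜ ≤ ε ∧
      (S.card : ℝ) ≤ Real.exp (N * (natEntropy q + δ)) ∧ (natEntropy q = 0 → S.card ≤ 1) := by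
  filter_upwards [eventually_massOf_atypical_le hq hδ hε, eventually_gt_atTop 0] with N hN hN0
  set c := ENNReal.ofReal (Real.exp (-(N * (natEntropy q + δ)))) with hc
  have hc0 : c ≠ 0 := by simpa [hc] using Real.exp_pos _
  -- At most `1 / d` blocks can have mass at least `d`. It is used with `d = c` for the size bound
  -- and with `d = 1` for a source of zero entropy.
  have key : ∀ {d : ℝ≥0∞}, d ≠ 0 → ∃ hf : {x | d ≤ iidMass q N x}.Finite,
      (hf.toFinset.card : ℝ≥0∞) ≤ 1 / d := fun hd => by
    simpa using ENNReal.finset_card_const_le_le_of_tsum_le (c := 1) ENNReal.one_ne_top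
      (tsum_iidMass q N).le hd
  obtain ⟨hfin, hcard⟩ := key hc0
  have hsub : {x | x ∉ atypical q δ N ∧ iidMass q N x ≠ 0} ⊆ {x | c ≤ iidMass q N x} :=
    fun x hx => le_iidMass_of_typical hN0 hx.1 hx.2
  have hfin' := hfin.subset hsub
  refine ⟨hfin'.toFinset, ?_, ?_, ?_⟩
  · refine (massOf_mono fun x hx h0 => ?_).trans hN
    by_contra hat
    exact hx (by simpa using ⟨hat, h0⟩)
  · have h1 : (hfin'.toFinset.card : ℝ≥0∞) ≤ 1 / c :=
      by
      refine le_trans ?_ hcard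
      exact_mod_cast Finset.card_le_card
        (Set.Finite.toFinset_mono (hs := hfin') (ht := hfin) hsub)
    have h2 : 1 / c = ENNReal.ofReal (Real.exp (N * (natEntropy q + δ))) := by
      rw [one_div, hc, ← ENNReal.ofReal_inv_of_pos (Real.exp_pos _), ← Real.exp_neg, neg_neg]
    rw [h2, ← ENNReal.ofReal_natCast] at h1
    exact (ENNReal.ofReal_le_ofReal_iff (Real.exp_pos _).le).1 h1
  · intro h
    obtain ⟨hfin₁, hcard₁⟩ := key one_ne_zero
    have hsub₁ : {x | x ∉ atypical q δ N ∧ iidMass q N x ≠ 0} ⊆ {x | 1 ≤ iidMass q N x} :=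
      fun x hx => (iidMass_eq_one_of_natEntropy_eq_zero hq h hx.2).ge
    have := (Finset.card_le_card (Set.Finite.toFinset_mono (hs := hfin') (ht := hfin₁) hsub₁))
    have h3 : hfin₁.toFinset.card ≤ 1 := by
      rw [div_one] at hcard₁
      exact_mod_cast hcard₁
    exact this.trans h3

end AsymptoticEquipartition

/-! ### Exact recovery of sparse vectors -/

section CompressedSensing

variable {m n : ℕ}

lemma IsSparse.mono {k l : ℕ} (hkl : k ≤ l) {v : Fin n → ℝ} (hv : IsSparse k v) : IsSparse l v :=
  le_trans hv hkl

lemma RIP.mono {A : Matrix (Fin m) (Fin n) ℝ} {k l : ℕ} {δ : ℝ} (hA : RIP A l δ) (hkl : k ≤ l) :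
    RIP A k δ :=
  fun v hv => hA v (hv.mono hkl)

lemma isSparse_of_support_subset {k : ℕ} {v : Fin n → ℝ} (s : Finset (Fin n)) (hs : s.card ≤ k)
    (hv : ∀ i, v i ≠ 0 → i ∈ s) : IsSparse k v := by
  refine le_trans ?_ hs
  rw [← Set.ncard_coe_finset]
  exact Set.ncard_le_ncard (fun i hi => hv i hi) s.finite_toSet

lemma IsSparse.add_smul {k l : ℕ} {u v : Fin n → ℝ} (hu : IsSparse k u) (hv : IsSparse l v)
    (s : ℝ) : IsSparse (k + l) (u + s • v) := by
  refine le_trans (Set.ncard_le_ncard (t := {i | u i ≠ 0} ∪ {i | v i ≠ 0}) (fun i hi => ?_)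
    (Set.toFinite _)) ((Set.ncard_union_le _ _).trans (add_le_add hu hv))
  by_contra h
  simp only [Set.mem_union, Set.mem_ofPred_eq, not_or, not_not] at h
  simp [h.1, h.2] at hi

/-- Sparse vectors with disjoint supports are mapped to almost orthogonal vectors. -/
lemma RIP.abs_dotProduct_le {A : Matrix (Fin m) (Fin n) ℝ} {k : ℕ} {δ : ℝ} (hδ : 0 ≤ δ)
    (hA : RIP A (2 * k) δ) {u v : Fin n → ℝ} (hu : IsSparse k u) (hv : IsSparse k v)
    (huv : ∀ i, u i * v i = 0) :
    |A.mulVec u ⬝ᵥ A.mulVec v| ≤ δ * (√(∑ i, u i ^ 2) * √(∑ i, v i ^ 2)) := by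
  have hnorm : ∀ s : ℝ, ∑ i, (u + s • v) i ^ 2 = ∑ i, u i ^ 2 + s ^ 2 * ∑ i, v i ^ 2 := by
    intro s
    rw [Finset.mul_sum, ← Finset.sum_add_distrib]
    refine Finset.sum_congr rfl fun i _ => ?_
    simp only [Pi.add_apply, Pi.smul_apply, smul_eq_mul]
    linear_combination 2 * s * huv i
  have himg : ∀ s : ℝ, ∑ j, (A.mulVec (u + s • v)) j ^ 2 = ∑ j, (A.mulVec u) j ^ 2 +
      2 * s * (A.mulVec u ⬝ᵥ A.mulVec v) + s ^ 2 * ∑ j, (A.mulVec v) j ^ 2 := by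
    intro s
    rw [dotProduct, Finset.mul_sum, Finset.mul_sum, ← Finset.sum_add_distrib,
      ← Finset.sum_add_distrib]
    refine Finset.sum_congr rfl fun i _ => ?_
    simp only [Matrix.mulVec_add, Matrix.mulVec_smul, Pi.add_apply, Pi.smul_apply, smul_eq_mul]
    ring
  have hsp : ∀ s : ℝ, IsSparse (2 * k) (u + s • v) := fun s => two_mul k ▸ hu.add_smul hv s
  set P := A.mulVec u ⬝ᵥ A.mulVec v
  -- Polarization: the lower bound for `u - s • v` is subtracted from the upper bound for `u + s •
  -- v`. The discriminant of the resulting quadratic in `s` gives the claim.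
  have hquad : ∀ s : ℝ,
      0 ≤ (δ * ∑ i, v i ^ 2) * (s * s) + (-2 * P) * s + δ * ∑ i, u i ^ 2 := by
    intro s
    have h₁ := (hA _ (hsp s)).2
    have h₂ := (hA _ (hsp (-s))).1
    rw [hnorm, himg] at h₁ h₂
    nlinarith
  have hdisc := discrim_le_zero hquad
  rw [discrim] at hdisc
  rw [← Real.sqrt_mul (Finset.sum_nonneg fun i _ => sq_nonneg _)]
  refine abs_le_of_sq_le_sq' ?_ (by positivity) |> abs_le.2
  rw [mul_pow, Real.sq_sqrt (by positivity)]
  nlinarith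

/-- The sum of absolute values over `S` is at most that over a set of at least as many elements
with the largest absolute values. -/
lemma sum_le_sum_largest {a : Fin n → ℝ} {S T : Finset (Fin n)} {c : ℝ} (hc : 0 ≤ c)
    (hT : ∀ i ∈ T, c ≤ a i) (hTc : ∀ i ∉ T, a i ≤ c) (hcard : S.card ≤ T.card) :
    ∑ i ∈ S, a i ≤ ∑ i ∈ T, a i := by
  have h₁ : ∑ i ∈ S, (a i - c) ≤ ∑ i ∈ T, (a i - c) := by
    calc ∑ i ∈ S, (a i - c) ≤ ∑ i ∈ S, max (a i - c) 0 :=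
          Finset.sum_le_sum fun i _ => le_max_left _ _
      _ ≤ ∑ i, max (a i - c) 0 := Finset.sum_le_sum_of_subset_of_nonneg (Finset.subset_univ _)
          fun i _ _ => le_max_right _ _
      _ = ∑ i ∈ T, max (a i - c) 0 := (Finset.sum_subset (Finset.subset_univ _)
          fun i _ hi => max_eq_right (sub_nonpos.2 (hTc i hi))).symm
      _ = ∑ i ∈ T, (a i - c) := Finset.sum_congr rfl
          fun i hi => max_eq_left (sub_nonneg.2 (hT i hi))
  simp only [Finset.sum_sub_distrib, Finset.sum_const, nsmul_eq_mul] at h₁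
  have : (S.card : ℝ) * c ≤ T.card * c := by gcongr
  linarith

/-- Null space property. -/
lemma eq_zero_of_mulVec_eq_zero_of_concentrated {A : Matrix (Fin m) (Fin n) ℝ} {k : ℕ} (hk : 0 < k)
    (hkn : k ≤ n) {δ₁ δ : ℝ} (hδ : 0 ≤ δ) (hsum : δ₁ + 2 * δ < 1) (hA₁ : RIP A k δ₁)
    (hA : RIP A (2 * k) δ) {h : Fin n → ℝ} (hker : A.mulVec h = 0) {S : Finset (Fin n)}
    (hS : S.card ≤ k) (hconc : ∑ i, |h i| ≤ 2 * ∑ i ∈ S, |h i|) : h = 0 := by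
  classical
  -- The coordinates are sorted by decreasing absolute value and cut into blocks `T j` of `k`; `w j`
  -- is the restriction of `h` to the block `j`.
  set σ := Tuple.sort fun i => -|h i| with hσ
  have hanti : ∀ i j : Fin n, i ≤ j → |h (σ j)| ≤ |h (σ i)| := fun i j hij =>
    neg_le_neg_iff.1 (Tuple.monotone_sort (fun i => -|h i|) hij)
  set b : Fin n → ℕ := fun i => (σ.symm i : ℕ) / k with hb
  set T : ℕ → Finset (Fin n) := fun j => Finset.univ.filter fun i => b i = j with hT
  set w : ℕ → Fin n → ℝ := fun j i => if b i = j then h i else 0 with hw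
  have hbn : ∀ i, b i < n := fun i => (Nat.div_le_self _ _).trans_lt (σ.symm i).2
  have hTcard : ∀ j, (T j).card ≤ k := by
    intro j
    have : (T j).card ≤ (Finset.Ico (j * k) ((j + 1) * k)).card := by
      refine Finset.card_le_card_of_injOn (fun i => (σ.symm i : ℕ)) (fun i hi => ?_)
        (fun i _ i' _ hii' => σ.symm.injective (Fin.ext hii'))
      have hi' : (σ.symm i : ℕ) / k = j := by simpa [hT, hb] using hi
      simp only [Finset.coe_Ico, Set.mem_Ico]
      exact ⟨(Nat.le_div_iff_mul_le hk).1 hi'.ge, (Nat.div_lt_iff_lt_mul hk).1 (by omega)⟩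
    simpa [add_mul] using this
  have hwsp : ∀ j, IsSparse k (w j) := fun j =>
    isSparse_of_support_subset (T j) (hTcard j) fun i hi => by
      by_contra hne
      exact hi (if_neg (by simpa [hT] using hne))
  set B : ℕ → ℝ := fun j => √(∑ i, w j i ^ 2) with hB
  set ℓ : ℕ → ℝ := fun j => ∑ i ∈ T j, |h i| with hℓ
  have hwsq : ∀ j, ∑ i, w j i ^ 2 = ∑ i ∈ T j, h i ^ 2 := by
    intro j
    rw [hT, Finset.sum_filter]
    refine Finset.sum_congr rfl fun i _ => ?_
    simp only [hw]
    split_ifs <;> simp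
  have hk' : (0 : ℝ) < k := by exact_mod_cast hk
  have hfull : ∀ j i, b i = j + 1 → k * |h i| ≤ ℓ j := by
    intro j i hi
    have hlow : (j + 1) * k ≤ (σ.symm i : ℕ) := (Nat.le_div_iff_mul_le hk).1 hi.ge
    have hlt : ∀ t : Fin k, j * k + t < n := fun t => by
      have := (σ.symm i).2
      have := t.2
      rw [add_mul] at hlow
      omega
    let f : Fin k → Fin n := fun t => σ ⟨j * k + t, hlt t⟩
    have hf : Function.Injective f := fun t t' htt' => by
      have := σ.injective htt'
      simpa [Fin.ext_iff] using this
    calc k * |h i| = ∑ _t : Fin k, |h i| := by simp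
      _ ≤ ∑ t, |h (f t)| := by
          refine Finset.sum_le_sum fun t _ => ?_
          have := hanti ⟨j * k + t, hlt t⟩ (σ.symm i) (by
            rw [Fin.le_def]
            have := t.2
            rw [add_mul] at hlow
            simp only
            omega)
          simpa [f] using this
      _ = ∑ i ∈ Finset.univ.image f, |h i| := by rw [Finset.sum_image fun _ _ _ _ h => hf h]
      _ ≤ ℓ j := by
          refine Finset.sum_le_sum_of_subset_of_nonneg (fun i hi => ?_) fun _ _ _ => abs_nonneg _
          obtain ⟨t, -, rfl⟩ := Finset.mem_image.1 hi
          simp only [hT, hb, f, Finset.mem_filter, Finset.mem_univ, true_and,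
            Equiv.symm_apply_apply]
          rw [mul_comm, Nat.mul_add_div hk, Nat.div_eq_of_lt t.2, add_zero]
  have hℓ0 : ∀ j, 0 ≤ ℓ j := fun j => Finset.sum_nonneg fun _ _ => abs_nonneg _
  -- Every entry of a block is at most the average of the preceding block, which is full. This
  -- trades Euclidean norms for `L¹` norms with a shift by one block.
  have hBℓ : ∀ j, B (j + 1) ≤ ℓ j / √k := by
    intro j
    simp only [hB, hwsq]
    refine Real.sqrt_le_iff.2 ⟨div_nonneg (hℓ0 j) (Real.sqrt_nonneg _), ?_⟩
    rw [div_pow, Real.sq_sqrt hk'.le]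
    calc ∑ i ∈ T (j + 1), h i ^ 2 ≤ ∑ i ∈ T (j + 1), (ℓ j / k) ^ 2 := by
          refine Finset.sum_le_sum fun i hi => ?_
          rw [← sq_abs]
          refine pow_le_pow_left₀ (abs_nonneg _) ?_ 2
          rw [le_div_iff₀ hk', mul_comm]
          exact hfull j i (by simpa [hT] using hi)
      _ = (T (j + 1)).card * (ℓ j / k) ^ 2 := by simp
      _ ≤ k * (ℓ j / k) ^ 2 := by
          gcongr
          exact_mod_cast hTcard _
      _ = ℓ j ^ 2 / k := by field_simp
  have hℓB : ℓ 0 ≤ √k * B 0 := by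
    simp only [hB, hwsq]
    rw [← Real.sqrt_mul hk'.le]
    refine Real.le_sqrt_of_sq_le (sq_sum_le_card_mul_sum_sq.trans ?_)
    simp only [sq_abs]
    gcongr
    exact_mod_cast hTcard 0
  have hℓsum : ∑ j ∈ Finset.range n, ℓ j = ∑ i, |h i| :=
    Finset.sum_fiberwise_of_maps_to (fun i _ => Finset.mem_range.2 (hbn i)) _
  have hT0 : ∑ i ∈ S, |h i| ≤ ℓ 0 := by
    have hmem0 : ∀ i, i ∈ T 0 ↔ (σ.symm i : ℕ) < k := fun i => by
      simp [hT, hb, Nat.div_eq_zero_iff, hk.ne']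
    have hcard0 : k ≤ (T 0).card := by
      have : (Finset.univ : Finset (Fin k)).card ≤ (T 0).card := by
        refine Finset.card_le_card_of_injOn (fun t => σ (Fin.castLE hkn t)) (fun t _ => ?_)
          (fun t _ t' _ h => by simpa using h)
        simp [hmem0]
      simpa using this
    have hkpos : k - 1 < n := by omega
    refine sum_le_sum_largest (c := |h (σ ⟨k - 1, hkpos⟩)|) (abs_nonneg _) (fun i hi => ?_)
      (fun i hi => ?_) (hS.trans hcard0)
    · rw [hmem0] at hi
      simpa using hanti (σ.symm i) ⟨k - 1, hkpos⟩ (by rw [Fin.le_def]; simp only; omega)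
    · rw [hmem0] at hi
      simpa using hanti ⟨k - 1, hkpos⟩ (σ.symm i) (by rw [Fin.le_def]; simp only; omega)
  have hdecomp : h = ∑ j ∈ Finset.range n, w j := by
    ext i
    simp [hw, Finset.sum_apply, hbn i]
  obtain ⟨n', rfl⟩ : ∃ n', n = n' + 1 := ⟨n - 1, by omega⟩
  -- As `A h = 0`, the square of `A (w 0)` equals minus its inner products with the other blocks.
  -- Near-orthogonality bounds these by `δ * B 0 * ∑ ℓ j / √k`, and concentration gives `∑ ℓ j ≤ 2 *
  -- ℓ 0 ≤ 2 * √k * B 0`.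
  have hmain : (1 - δ₁) * B 0 ^ 2 ≤ 2 * δ * B 0 ^ 2 := by
    have hsq : B 0 ^ 2 = ∑ i, w 0 i ^ 2 := Real.sq_sqrt (Finset.sum_nonneg fun _ _ => sq_nonneg _)
    have hlower := (hA₁ _ (hwsp 0)).1
    rw [← hsq] at hlower
    have hzero : A.mulVec (w 0) ⬝ᵥ A.mulVec h = 0 := by rw [hker, dotProduct_zero]
    rw [hdecomp, Finset.sum_range_succ', Matrix.mulVec_add, dotProduct_add,
      Matrix.mulVec_sum, dotProduct_sum] at hzero
    have hself : A.mulVec (w 0) ⬝ᵥ A.mulVec (w 0) = ∑ j, (A.mulVec (w 0)) j ^ 2 := by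
      simp [dotProduct, sq]
    have hcross : ∀ j ∈ Finset.range n', -(A.mulVec (w 0) ⬝ᵥ A.mulVec (w (j + 1))) ≤
        δ * (B 0 * (ℓ j / √k)) := by
      intro j _
      refine (neg_le_abs _).trans
        ((hA.abs_dotProduct_le hδ (hwsp 0) (hwsp (j + 1)) fun i => ?_).trans ?_)
      · simp only [hw]
        by_cases hi : b i = 0
        · rw [if_neg (show ¬ b i = j + 1 by omega), mul_zero]
        · rw [if_neg hi, zero_mul]
      · have : 0 ≤ B 0 := Real.sqrt_nonneg _
        have := hBℓ j
        gcongr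
    have hsumle : ∑ j ∈ Finset.range n', ℓ j ≤ 2 * (√k * B 0) := by
      rw [Finset.sum_range_succ] at hℓsum
      linarith [hℓ0 n']
    have h5 := Finset.sum_le_sum hcross
    rw [Finset.sum_neg_distrib, ← Finset.mul_sum, ← Finset.mul_sum, ← Finset.sum_div] at h5
    have hsk : 0 < √(k : ℝ) := Real.sqrt_pos.2 hk'
    have h6 : (∑ j ∈ Finset.range n', ℓ j) / √k ≤ 2 * B 0 := by
      rw [div_le_iff₀ hsk]
      linarith
    have hB0 : 0 ≤ B 0 := Real.sqrt_nonneg _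
    have h7 : δ * (B 0 * ((∑ j ∈ Finset.range n', ℓ j) / √k)) ≤ δ * (B 0 * (2 * B 0)) := by gcongr
    nlinarith
  have hB0 : B 0 = 0 := by
    by_contra hne
    have : 0 < B 0 ^ 2 := by positivity
    nlinarith
  rw [hB0, mul_zero] at hℓB
  have hz : ∑ i, |h i| = 0 :=
    le_antisymm (by linarith) (Finset.sum_nonneg fun _ _ => abs_nonneg _)
  ext i
  exact abs_eq_zero.1 ((Finset.sum_eq_zero_iff_of_nonneg fun _ _ => abs_nonneg _).1 hz i (by simp))

/-- `L¹` minimization recovers sparse vectors exactly. -/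
theorem IsL1Minimizer.eq_of_isSparse {A : Matrix (Fin m) (Fin n) ℝ} {k : ℕ} (hk : 1 ≤ k)
    (hkn : k ≤ n) (hA : SatisfiesRIP A k) {x z : Fin n → ℝ} (hz : IsSparse k z)
    (hx : IsL1Minimizer A (A.mulVec z) x) : x = z := by
  classical
  obtain ⟨δ₁, δ₂, δ₃, -, h₂, h₃, hsum, hA₁, hA₂, hA₃⟩ := hA
  -- The smaller of `δ₂` and `δ₃` serves for order `2k`, and twice it is at most `δ₂ + δ₃`.
  obtain ⟨δ, hδ, hδsum, hAδ⟩ : ∃ δ : ℝ, 0 ≤ δ ∧ δ₁ + 2 * δ < 1 ∧ RIP A (2 * k) δ := by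
    rcases le_total δ₂ δ₃ with h | h
    · exact ⟨δ₂, h₂.le, by linarith, hA₂⟩
    · exact ⟨δ₃, h₃.le, by linarith, hA₃.mono (by omega)⟩
  set S := Finset.univ.filter fun i => z i ≠ 0 with hS
  have hScard : S.card ≤ k := by
    rw [IsSparse, Set.ncard_eq_toFinset_card'] at hz
    convert hz using 2
    ext; simp [hS]
  refine sub_eq_zero.1 (eq_zero_of_mulVec_eq_zero_of_concentrated (h := x - z) (S := S) hk hkn hδ
    hδsum hA₁ hAδ (by rw [Matrix.mulVec_sub, hx.1, sub_self]) hScard ?_)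
  have hle := hx.2 z rfl
  -- Summed over `i` and combined with `‖x‖₁ ≤ ‖z‖₁`, this shows that `x - z` has at least half of
  -- its `L¹` norm on the support of `z`.
  have key : ∀ i, |(x - z) i| + |z i| - |x i| ≤ if i ∈ S then 2 * |(x - z) i| else 0 := by
    intro i
    split_ifs with hi
    · have := abs_sub_abs_le_abs_sub (z i) (x i)
      rw [abs_sub_comm] at this
      simp only [Pi.sub_apply]
      linarith
    · have : z i = 0 := by simpa [hS] using hi
      simp [this]
  have := Finset.sum_le_sum fun i (_ : i ∈ Finset.univ) => key i
  rw [Finset.sum_sub_distrib, Finset.sum_add_distrib, Finset.sum_ite_mem, Finset.univ_inter,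
    ← Finset.mul_sum] at this
  linarith

end CompressedSensing

/-! ### Random linear network coding in rounds -/

section RandomCode

open Finset

variable {V X I : Type*} [AddCommGroup X] [Module (ZMod 2) X]

/-- Translation by `f₀` exchanges the kernel with its complement: a non-zero functional at a uniform
point is a fair coin. -/
lemma two_mul_card_filter_eq_zero {U : Type*} [AddCommGroup U] [Fintype U] [DecidableEq U]
    (φ : U →+ ZMod 2) {f₀ : U} (h : φ f₀ ≠ 0) :
    2 * (univ.filter fun f => φ f = 0).card = Fintype.card U := by
  have hz : ∀ x y : ZMod 2, x ≠ 0 → y ≠ 0 → x + y = 0 := by decide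
  have h₁ : (univ.filter fun f => ¬ φ f = 0).card = (univ.filter fun f => φ f = 0).card := by
    refine card_bij (fun f _ => f + f₀) (fun f hf => ?_) (fun f _ g _ hfg => by simpa using hfg)
      (fun f hf => ⟨f - f₀, ?_, by simp⟩)
    · simpa using hz _ _ (mem_filter.1 hf).2 h
    · simpa [(mem_filter.1 hf).2] using h
  have := card_filter_add_card_filter_not (s := (univ : Finset U)) fun f => φ f = 0
  rw [card_univ] at this
  omega

/-- The nodes at which the functional `e` does not vanish, when `K v` is spanned by what is
available at the node `v`. -/
def visible (K : V → Submodule (ZMod 2) X) (e : X →ₗ[ZMod 2] ZMod 2) : Set V :=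
  {v | ∃ f ∈ K v, e f ≠ 0}

/-- What is available at the nodes after one more round of transmissions `l`. -/
def nextRound (tgt : I → V) (K : V → Submodule (ZMod 2) X) (l : I → X) (v : V) :
    Submodule (ZMod 2) X :=
  K v ⊔ Submodule.span (ZMod 2) (l '' {i | tgt i = v})

lemma visible_subset_nextRound (tgt : I → V) (K : V → Submodule (ZMod 2) X) (l : I → X)
    (e : X →ₗ[ZMod 2] ZMod 2) : visible K e ⊆ visible (nextRound tgt K l) e :=
  fun _ ⟨f, hf, hef⟩ => ⟨f, Submodule.mem_sup_left hf, hef⟩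

lemma mem_visible_nextRound {tgt : I → V} {K : V → Submodule (ZMod 2) X} {l : I → X}
    {e : X →ₗ[ZMod 2] ZMod 2} {i : I} (h : e (l i) ≠ 0) :
    tgt i ∈ visible (nextRound tgt K l) e :=
  ⟨l i, Submodule.mem_sup_right (Submodule.subset_span ⟨i, rfl, rfl⟩), h⟩

/-- Only heads of transmissions can be newly reached. For this reason `deficit` counts only heads
and stays bounded by the number of edges, even if there are infinitely many nodes. -/
lemma mem_range_of_mem_visible_nextRound {tgt : I → V} {K : V → Submodule (ZMod 2) X} {l : I → X}
    {e : X →ₗ[ZMod 2] ZMod 2} {v : V} (h : v ∈ visible (nextRound tgt K l) e)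
    (h' : v ∉ visible K e) : ∃ i, tgt i = v := by
  by_contra hne
  push Not at hne
  have hempty : {i | tgt i = v} = ∅ := Set.eq_empty_of_forall_notMem hne
  obtain ⟨f, hf, hef⟩ := h
  rw [nextRound, hempty, Set.image_empty, Submodule.span_empty, sup_bot_eq] at hf
  exact h' ⟨f, hf, hef⟩

/-- What is available after the first `d` rounds of the transmissions `L`. -/
def knowledge (tgt : I → V) (K₀ : V → Submodule (ZMod 2) X) (L : ℕ → I → X) (d : ℕ) (v : V) :
    Submodule (ZMod 2) X :=
  K₀ v ⊔ Submodule.span (ZMod 2) ((fun y : ℕ × I => L y.1 y.2) '' {y | y.1 < d ∧ tgt y.2 = v})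

lemma knowledge_zero (tgt : I → V) (K₀ : V → Submodule (ZMod 2) X) (L : ℕ → I → X) :
    knowledge tgt K₀ L 0 = K₀ := by
  ext v : 1
  simp [knowledge]

lemma knowledge_congr (tgt : I → V) (K₀ : V → Submodule (ZMod 2) X) {L L' : ℕ → I → X} {d : ℕ}
    (h : ∀ d' < d, L d' = L' d') : knowledge tgt K₀ L d = knowledge tgt K₀ L' d := by
  ext v : 1
  rw [knowledge, knowledge]
  congr 2
  exact Set.image_congr fun y hy => congrFun (h _ hy.1) _

lemma knowledge_succ (tgt : I → V) (K₀ : V → Submodule (ZMod 2) X) (L : ℕ → I → X) (d : ℕ) :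
    knowledge tgt K₀ L (d + 1) = nextRound tgt (knowledge tgt K₀ L d) (L d) := by
  ext v : 1
  rw [nextRound, knowledge, knowledge, sup_assoc, ← Submodule.span_union]
  congr 2
  ext f
  simp only [Set.mem_image, Set.mem_ofPred_eq, Prod.exists, Set.mem_union]
  constructor
  · rintro ⟨d', i, ⟨hd, ht⟩, rfl⟩
    rcases Nat.lt_succ_iff_lt_or_eq.1 hd with h | rfl
    · exact Or.inl ⟨d', i, ⟨h, ht⟩, rfl⟩
    · exact Or.inr ⟨i, ht, rfl⟩
  · rintro (⟨d', i, ⟨hd, ht⟩, rfl⟩ | ⟨i, ht, rfl⟩)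
    · exact ⟨d', i, ⟨by omega, ht⟩, rfl⟩
    · exact ⟨d, i, ⟨by omega, ht⟩, rfl⟩

lemma le_knowledge (tgt : I → V) (K₀ : V → Submodule (ZMod 2) X) (L : ℕ → I → X) (d : ℕ) (v : V) :
    K₀ v ≤ knowledge tgt K₀ L d v := le_sup_left

variable [Fintype I]

open Classical in
/-- Number of nodes outside `W` that can still be reached. -/
noncomputable def deficit (tgt : I → V) (W : Set V) : ℕ :=
  ((univ.image tgt).filter fun v => v ∉ W).card

open Classical in
/-- The transmissions that leave `W`. -/
noncomputable def leaving (src tgt : I → V) (W : Set V) : Finset I :=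
  univ.filter fun i => src i ∈ W ∧ tgt i ∉ W

open Classical in
/-- Bound on the probability that a node `t` does not see `e` after `d` more rounds, when the nodes
in `W` see it and `θ` bounds the probability that nothing new happens in a round. -/
noncomputable def failureBound (tgt : I → V) (θ : ℝ) (d : ℕ) (t : V) (W : Set V) : ℝ :=
  if t ∈ W then 0 else 2 ^ d * θ ^ d / θ ^ deficit tgt W

lemma failureBound_nonneg (tgt : I → V) {θ : ℝ} (hθ : 0 < θ) (d : ℕ) (t : V) (W : Set V) :
    0 ≤ failureBound tgt θ d t W := by
  unfold failureBound
  split_ifs <;> positivity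

open Classical in
-- Each transmission is chosen independently and uniformly from what its tail knows. Where the tail
-- sees `e`, the value of `e` is a fair coin.
lemma card_choices_vanishing [DecidableEq I] {src : I → V} (K : V → Submodule (ZMod 2) X)
    [∀ v, Fintype (K v)] (e : X →ₗ[ZMod 2] ZMod 2) (C : Finset I)
    (hC : ∀ i ∈ C, src i ∈ visible K e) :
    ((univ.filter fun l : (i : I) → K (src i) => ∀ i ∈ C, e (l i) = 0).card : ℝ) =
      Fintype.card ((i : I) → K (src i)) * (1 / 2) ^ C.card := by
  have h₁ : (univ.filter fun l : (i : I) → K (src i) => ∀ i ∈ C, e (l i) = 0) =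
      Fintype.piFinset fun i => univ.filter fun f : K (src i) => i ∈ C → e f = 0 := by
    ext l; simp [Fintype.mem_piFinset]
  rw [h₁, Fintype.card_piFinset, Fintype.card_pi, Nat.cast_prod, Nat.cast_prod,
    ← prod_const, ← Fintype.prod_ite_mem (s := C) (f := fun _ => (1 / 2 : ℝ)),
    ← prod_mul_distrib]
  refine prod_congr rfl fun i _ => ?_
  by_cases hi : i ∈ C
  · obtain ⟨f, hf, hef⟩ := hC i hi
    have := two_mul_card_filter_eq_zero (e.toAddMonoidHom.comp (K (src i)).subtype.toAddMonoidHom)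
      (f₀ := ⟨f, hf⟩) (by simpa using hef)
    simp only [hi, forall_const, if_true, ← this]
    push_cast
    simp
    ring_nf
    congr!
  · simp [hi]

lemma deficit_lt_of_ne {tgt : I → V} {K : V → Submodule (ZMod 2) X} {l : I → X}
    {e : X →ₗ[ZMod 2] ZMod 2} (h : visible (nextRound tgt K l) e ≠ visible K e) :
    deficit tgt (visible (nextRound tgt K l) e) < deficit tgt (visible K e) := by
  classical
  have hsub := visible_subset_nextRound tgt K l e
  obtain ⟨v, hv, hv'⟩ := Set.exists_of_ssubset (hsub.ssubset_of_ne h.symm)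
  obtain ⟨i, rfl⟩ := mem_range_of_mem_visible_nextRound hv hv'
  refine card_lt_card (ssubset_iff_of_subset
    (fun x hx => ?_) |>.2 ⟨tgt i, by simp [hv'], by simp [hv]⟩)
  rw [mem_filter] at hx ⊢
  exact ⟨hx.1, fun h => hx.2 (hsub h)⟩

/-- On average over the choice of the transmissions of a round, the failure bound decreases. -/
lemma sum_failureBound_le [DecidableEq I] {src tgt : I → V}
    (K : V → Submodule (ZMod 2) X) [∀ v, Fintype (K v)] (e : X →ₗ[ZMod 2] ZMod 2) (t : V) {θ : ℝ}
    (hθ : 0 < θ) (hθ₁ : θ ≤ 1)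
    (hcut : t ∉ visible K e → (1 / 2 : ℝ) ^ (leaving src tgt (visible K e)).card ≤ θ) (d : ℕ) :
    ∑ l : (i : I) → K (src i),
        failureBound tgt θ d t (visible (nextRound tgt K fun i => (l i : X)) e) ≤
      ∑ _l : (i : I) → K (src i), failureBound tgt θ (d + 1) t (visible K e) := by
  classical
  by_cases ht : t ∈ visible K e
  · refine sum_le_sum fun l _ => ?_
    rw [failureBound, if_pos (visible_subset_nextRound _ _ _ _ ht)]
    exact failureBound_nonneg _ hθ _ _ _
  set W := visible K e with hW
  set φ := failureBound tgt θ (d + 1) t W with hφ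
  have hφ' : φ = 2 ^ (d + 1) * θ ^ (d + 1) / θ ^ deficit tgt W := if_neg ht
  set stay : ((i : I) → K (src i)) → Prop := fun l => ∀ i ∈ leaving src tgt W, e (l i) = 0
  have hpt : ∀ l : (i : I) → K (src i),
      failureBound tgt θ d t (visible (nextRound tgt K fun i => (l i : X)) e) ≤
        (if stay l then φ / (2 * θ) else 0) + φ / 2 := by
    intro l
    set W' := visible (nextRound tgt K fun i => (l i : X)) e with hW'
    have hφ0 : 0 ≤ φ := failureBound_nonneg _ hθ _ _ _
    -- If nothing new happens, the bound grows by `1 / (2 * θ)`, but this has probability at most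
    -- `θ`. Otherwise the deficit drops and the bound is at most `φ / 2`. Both cases contribute at
    -- most `φ / 2` on average.
    by_cases hWW : W' = W
    · have hstay : stay l := by
        intro i hi
        by_contra hne
        have h₁ : tgt i ∈ W' := mem_visible_nextRound hne
        rw [leaving, mem_filter] at hi
        exact hi.2.2 (hWW ▸ h₁)
      rw [if_pos hstay, hWW, failureBound, if_neg ht]
      have : φ / (2 * θ) = 2 ^ d * θ ^ d / θ ^ deficit tgt W := by
        rw [hφ', pow_succ, pow_succ]
        field_simp
      rw [this]
      linarith
    · have hlt : deficit tgt W' < deficit tgt W := deficit_lt_of_ne hWW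
      have h₁ : failureBound tgt θ d t W' ≤ φ / 2 := by
        rw [failureBound]
        split_ifs
        · positivity
        · rw [hφ', div_div, div_le_div_iff₀ (by positivity) (by positivity)]
          have : θ ^ deficit tgt W ≤ θ ^ (deficit tgt W' + 1) :=
            pow_le_pow_of_le_one hθ.le hθ₁ hlt
          calc 2 ^ d * θ ^ d * (θ ^ deficit tgt W * 2)
              ≤ 2 ^ d * θ ^ d * (θ ^ (deficit tgt W' + 1) * 2) := by gcongr
            _ = 2 ^ (d + 1) * θ ^ (d + 1) * θ ^ deficit tgt W' := by ring
      have : 0 ≤ if stay l then φ / (2 * θ) else 0 := by split_ifs <;> positivity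
      linarith
  have hcard := card_choices_vanishing (src := src) K e (leaving src tgt W) fun i hi => by
    rw [leaving, mem_filter] at hi
    exact hi.2.1
  calc _ ≤ ∑ l : (i : I) → K (src i), ((if stay l then φ / (2 * θ) else 0) + φ / 2) :=
        sum_le_sum fun l _ => hpt l
    _ = (univ.filter stay).card * (φ / (2 * θ)) +
        Fintype.card ((i : I) → K (src i)) * (φ / 2) := by
        rw [sum_add_distrib, ← sum_filter, sum_const, sum_const, nsmul_eq_mul, nsmul_eq_mul,
          card_univ]
    _ ≤ Fintype.card ((i : I) → K (src i)) * θ * (φ / (2 * θ)) +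
        Fintype.card ((i : I) → K (src i)) * (φ / 2) := by
        have h₂ : ((univ.filter stay).card : ℝ) ≤ Fintype.card ((i : I) → K (src i)) * θ := by
          have h₃ := hcut ht
          calc ((univ.filter stay).card : ℝ) =
              Fintype.card ((i : I) → K (src i)) * (1 / 2) ^ (leaving src tgt W).card := by
                rw [← hcard]
            _ ≤ _ := by gcongr
        have : 0 ≤ φ := failureBound_nonneg _ hθ _ _ _
        gcongr
    _ = ∑ _l : (i : I) → K (src i), φ := by
        rw [sum_const, nsmul_eq_mul, card_univ]
        field_simp
        ring

/-- Random linear network coding: if the failure bounds sum up to less than one, then some choice of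
the transmissions lets every node `t p` see the functional `e p`. -/
theorem exists_transmissions [Finite X] {P : Type*} [Fintype P] {src tgt : I → V}
    (K₀ : V → Submodule (ZMod 2) X) (e : P → X →ₗ[ZMod 2] ZMod 2) (t : P → V) (θ : P → ℝ)
    (hθ : ∀ p, 0 < θ p) (hθ₁ : ∀ p, θ p ≤ 1)
    (hcut : ∀ p W, visible K₀ (e p) ⊆ W → t p ∉ W →
      (1 / 2 : ℝ) ^ (leaving src tgt W).card ≤ θ p) (D : ℕ)
    (hD : ∑ p, failureBound tgt (θ p) D (t p) (visible K₀ (e p)) < 1) :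
    ∃ L : ℕ → I → X, (∀ d < D, ∀ i, L d i ∈ knowledge tgt K₀ L d (src i)) ∧
      ∀ p, t p ∈ visible (knowledge tgt K₀ L D) (e p) := by
  classical
  -- Method of conditional expectations: each round is fixed so that the total failure bound does
  -- not exceed its average, hence stays below one.
  have key : ∀ d ≤ D, ∃ L : ℕ → I → X,
      (∀ d' < d, ∀ i, L d' i ∈ knowledge tgt K₀ L d' (src i)) ∧
      ∑ p, failureBound tgt (θ p) (D - d) (t p) (visible (knowledge tgt K₀ L d) (e p)) < 1 := by
    intro d
    induction d with
    | zero => exact fun _ => ⟨fun _ _ => 0, by simp, by simpa [knowledge_zero] using hD⟩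
    | succ d ih =>
      intro hd
      obtain ⟨L, hL, hsum⟩ := ih (by omega)
      set K := knowledge tgt K₀ L d with hK
      have := fun v => Fintype.ofFinite (K v)
      obtain ⟨l, -, hl⟩ := exists_le_of_sum_le
        (s := (univ : Finset ((i : I) → K (src i))))
        (f := fun l => ∑ p, failureBound tgt (θ p) (D - (d + 1)) (t p)
          (visible (nextRound tgt K fun i => (l i : X)) (e p)))
        (g := fun _ => ∑ p, failureBound tgt (θ p) (D - d) (t p) (visible K (e p)))
        ⟨fun _ => 0, mem_univ _⟩ (by
          refine sum_comm.trans_le (le_trans (sum_le_sum fun p _ => ?_) sum_comm.le)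
          have hDd : D - d = D - (d + 1) + 1 := by omega
          rw [hDd]
          refine sum_failureBound_le K (e p) (t p) (hθ p) (hθ₁ p) (fun ht => ?_) _
          exact hcut p _ (fun v ⟨f, hf, hef⟩ => ⟨f, le_knowledge _ _ _ _ _ hf, hef⟩) ht)
      have hL' : ∀ d' < d, Function.update L d (fun i => (l i : X)) d' = L d' :=
        fun d' hd' => Function.update_of_ne hd'.ne _ _
      have hLd : ∀ d' ≤ d, knowledge tgt K₀ (Function.update L d fun i => (l i : X)) d' =
          knowledge tgt K₀ L d' :=
        fun d' hd' => knowledge_congr _ _ fun d'' hd'' => hL' _ (by omega)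
      refine ⟨Function.update L d fun i => (l i : X), fun d' hd' i => ?_, ?_⟩
      · rw [hLd d' (by omega)]
        rcases Nat.lt_succ_iff_lt_or_eq.1 hd' with h | rfl
        · rw [hL' d' h]
          exact hL d' h i
        · rw [Function.update_self]
          exact (l i).2
      · rw [knowledge_succ, hLd d le_rfl, Function.update_self]
        exact hl.trans_lt hsum
  obtain ⟨L, hL, hsum⟩ := key D le_rfl
  refine ⟨L, hL, fun p => ?_⟩
  by_contra hp
  -- With no rounds left, the bound of an unsatisfied pair is `1 / θ ^ deficit ≥ 1`.
  refine absurd ((single_le_sum (fun p _ => failureBound_nonneg tgt (hθ p) _ _ _)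
    (mem_univ p)).trans_lt hsum) (not_lt.2 ?_)
  rw [failureBound, if_neg hp, Nat.sub_self, pow_zero, pow_zero, mul_one, one_div]
  exact (one_le_inv₀ (pow_pos (hθ p) _)).2 (pow_le_one₀ (hθ p).le (hθ₁ p))

end RandomCode

/-! ### From available functionals to linear network codes -/

section Realization

open Finset

lemma exists_coeff_of_mem_span_image {α R X : Type*} [Fintype α] [Semiring R] [AddCommMonoid X]
    [Module R X] {v : α → X} {S : Set α} {x : X} (hx : x ∈ Submodule.span R (v '' S)) :
    ∃ c : α → R, (∀ a, c a ≠ 0 → a ∈ S) ∧ ∑ a, c a • v a = x := by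
  obtain ⟨l, hl, rfl⟩ := (Finsupp.mem_span_image_iff_linearCombination R).1 hx
  refine ⟨l, fun a ha => ?_, ?_⟩
  · exact (Finsupp.mem_supported R l).1 hl (Finsupp.mem_support_iff.2 ha)
  · rw [Finsupp.linearCombination_apply, Finsupp.sum_fintype]
    simp

variable {V E : Type*} {n T m : ℕ}

/-- The functional that reads the symbol `x.2` of the source `x.1`. -/
def coordFunctional (len : Fin m → ℕ) (x : Σ j, Fin (len j)) :
    Module.Dual (ZMod 2) ((j : Fin m) → Fin (len j) → ZMod 2) :=
  LinearMap.proj x.2 ∘ₗ LinearMap.proj x.1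

/-- What is available at the node `v` before any transmission. -/
def sourceKnowledge (G : Network V E n T) (act : Fin m ↪ Fin n) (len : Fin m → ℕ) (v : V) :
    Submodule (ZMod 2) (Module.Dual (ZMod 2) ((j : Fin m) → Fin (len j) → ZMod 2)) :=
  Submodule.span (ZMod 2) (coordFunctional len '' {x | G.source (act x.1) = v})

lemma mem_visible_sourceKnowledge (G : Network V E n T) (act : Fin m ↪ Fin n) (len : Fin m → ℕ)
    {w : (j : Fin m) → Fin (len j) → ZMod 2} {j : Fin m} (hw : w j ≠ 0) :
    G.source (act j) ∈ visible (sourceKnowledge G act len) (Module.Dual.eval (ZMod 2) _ w) := by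
  obtain ⟨l, hl⟩ := Function.ne_iff.1 hw
  exact ⟨coordFunctional len ⟨j, l⟩, Submodule.subset_span ⟨⟨j, l⟩, rfl, rfl⟩, hl⟩

/-- The code with `D` rounds in which the transmission `i` of every round uses the edge
`edgeOf i`. -/
def roundCode {I : Type*} [Fintype I] {G : Network V E n T} {act : Fin m ↪ Fin n}
    (len : Fin m → ℕ) {D K : ℕ} (edgeOf : I → E) (idx : Fin K ≃ Fin D × I)
    (hidx : ∀ r s, (idx r).1 < (idx s).1 → r < s)
    (a : Fin D × I → (Σ j, Fin (len j)) → ZMod 2) (b : Fin D × I → Fin D × I → ZMod 2)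
    (ha : ∀ y x, a y x ≠ 0 → G.source (act x.1) = G.src (edgeOf y.2))
    (hb : ∀ y z, b y z ≠ 0 → z.1 < y.1 ∧ G.tgt (edgeOf z.2) = G.src (edgeOf y.2)) :
    LinearNetworkCode G act where
  F := ZMod 2
  len := len
  K := K
  edge s := edgeOf (idx s).2
  srcCoeff s j l := a (idx s) ⟨j, l⟩
  relayCoeff s r := b (idx s) (idx r)
  src_local _ _ _ h := ha _ _ h
  relay_local _ _ h := ⟨hidx _ _ (hb _ _ h).1, (hb _ _ h).2⟩

lemma LinearNetworkCode.symbol_eq {G : Network V E n T} {act : Fin m ↪ Fin n}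
    (C : LinearNetworkCode G act) (w : (j : Fin m) → Fin (C.len j) → C.F) (s : Fin C.K) :
    C.symbol w s = ∑ j, ∑ l, C.srcCoeff s j l * w j l +
      ∑ r : {r : Fin C.K // r < s}, C.relayCoeff s r.1 * C.symbol w r.1 := by
  rw [symbol]

section

variable {I : Type*} [Fintype I] {G : Network V E n T} {act : Fin m ↪ Fin n}
  {len : Fin m → ℕ} {D K : ℕ} {edgeOf : I → E} {idx : Fin K ≃ Fin D × I}
  {hidx : ∀ r s, (idx r).1 < (idx s).1 → r < s}
  {a : Fin D × I → (Σ j, Fin (len j)) → ZMod 2} {b : Fin D × I → Fin D × I → ZMod 2}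
  {ha : ∀ y x, a y x ≠ 0 → G.source (act x.1) = G.src (edgeOf y.2)}
  {hb : ∀ y z, b y z ≠ 0 → z.1 < y.1 ∧ G.tgt (edgeOf z.2) = G.src (edgeOf y.2)}

lemma roundCode_symbol
    {L : Fin D × I → Module.Dual (ZMod 2) ((j : Fin m) → Fin (len j) → ZMod 2)}
    (hL : ∀ y, ∑ x, a y x • coordFunctional len x + ∑ z, b y z • L z = L y)
    (w : (j : Fin m) → Fin (len j) → ZMod 2) (s : Fin K) :
    (roundCode len edgeOf idx hidx a b ha hb).symbol w s = L (idx s) w := by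
  induction s using WellFoundedLT.induction with
  | _ s ih =>
    refine (LinearNetworkCode.symbol_eq (roundCode len edgeOf idx hidx a b ha hb) w s).trans ?_
    let σ : Fin K → ZMod 2 := fun r => (roundCode len edgeOf idx hidx a b ha hb).symbol w r
    change ∑ j, ∑ l, a (idx s) ⟨j, l⟩ * w j l +
      ∑ r : {r : Fin K // r < s}, b (idx s) (idx r.1) * σ r.1 = L (idx s) w
    have h₁ : ∑ r : {r : Fin K // r < s}, b (idx s) (idx r.1) * σ r.1 =
        ∑ z, b (idx s) z * L z w := by
      rw [← idx.sum_comp, ← sum_subset (subset_univ (univ.filter fun r => r < s)),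
        sum_subtype (univ.filter fun r => r < s) (p := fun r => r < s) (by simp)]
      · exact sum_congr rfl fun r _ => by rw [show σ r.1 = L (idx r.1) w from ih r.1 r.2]
      · intro r _ hr
        by_cases hb0 : b (idx s) (idx r) = 0
        · rw [hb0, zero_mul]
        · exact absurd (hidx _ _ (hb _ _ hb0).1) (by simpa using hr)
    rw [h₁, ← hL (idx s), LinearMap.add_apply, LinearMap.sum_apply, LinearMap.sum_apply,
      Fintype.sum_sigma]
    rfl

lemma roundCode_edgeBits (e : E) : (roundCode len edgeOf idx hidx a b ha hb).edgeBits e =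
    D * Nat.card {i // edgeOf i = e} := by
  have h₁ : Nat.card {s : Fin K // edgeOf (idx s).2 = e} = D * Nat.card {i // edgeOf i = e} := by
    let eqv : {s : Fin K // edgeOf (idx s).2 = e} ≃ Fin D × {i // edgeOf i = e} :=
      { toFun := fun s => ((idx s.1).1, ⟨(idx s.1).2, s.2⟩)
        invFun := fun y => ⟨idx.symm (y.1, y.2.1), by simpa using y.2.2⟩
        left_inv := fun s => by simp
        right_inv := fun y => by simp }
    rw [Nat.card_congr eqv, Nat.card_prod, Nat.card_fin]
  have h₂ : (Fintype.card (roundCode len edgeOf idx hidx a b ha hb).F : ℝ) = 2 := by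
    exact_mod_cast ZMod.card 2
  rw [LinearNetworkCode.edgeBits, h₂, Real.logb_self_eq_one one_lt_two, mul_one]
  exact_mod_cast h₁

end

/-- Transmissions of functionals that are available at the tails of the edges are realized by a
linear network code. -/
theorem exists_code_of_transmissions (G : Network V E n T) (act : Fin m ↪ Fin n)
    (len : Fin m → ℕ) {I : Type*} [Fintype I] (edgeOf : I → E) (D : ℕ)
    (L : ℕ → I → Module.Dual (ZMod 2) ((j : Fin m) → Fin (len j) → ZMod 2))
    (hL : ∀ d < D, ∀ i, L d i ∈ knowledge (fun i => G.tgt (edgeOf i))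
      (sourceKnowledge G act len) L d (G.src (edgeOf i)))
    (hvis : ∀ t, ∀ w ≠ 0, G.receiver t ∈ visible (knowledge (fun i => G.tgt (edgeOf i))
      (sourceKnowledge G act len) L D) (Module.Dual.eval (ZMod 2) _ w)) :
    ∃ C : LinearNetworkCode G act, (∀ j, Nat.card (Fin (C.len j) → C.F) = 2 ^ len j) ∧
      (∀ e, C.edgeBits e = D * Nat.card {i // edgeOf i = e}) ∧
      ∀ t, Function.Injective (C.received t) := by
  classical
  set tgt : I → V := fun i => G.tgt (edgeOf i) with htgt
  have hcoeff : ∀ y : Fin D × I, ∃ (a : (Σ j, Fin (len j)) → ZMod 2) (b : Fin D × I → ZMod 2),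
      (∀ x, a x ≠ 0 → G.source (act x.1) = G.src (edgeOf y.2)) ∧
      (∀ z, b z ≠ 0 → z.1 < y.1 ∧ G.tgt (edgeOf z.2) = G.src (edgeOf y.2)) ∧
      ∑ x, a x • coordFunctional len x + ∑ z, b z • L z.1 z.2 = L y.1 y.2 := by
    rintro ⟨d, i⟩
    obtain ⟨f, hf, g, hg, hfg⟩ := Submodule.mem_sup.1 (hL d d.2 i)
    obtain ⟨a, ha, rfl⟩ := exists_coeff_of_mem_span_image hf
    have himg : (fun y : ℕ × I => L y.1 y.2) '' {y | y.1 < d ∧ tgt y.2 = G.src (edgeOf i)} =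
        (fun y : Fin D × I => L y.1 y.2) '' {y | y.1 < d ∧ tgt y.2 = G.src (edgeOf i)} := by
      ext f
      constructor
      · rintro ⟨⟨d', i'⟩, ⟨h₁, h₂⟩, rfl⟩
        exact ⟨(⟨d', h₁.trans d.2⟩, i'), ⟨h₁, h₂⟩, rfl⟩
      · rintro ⟨⟨d', i'⟩, ⟨h₁, h₂⟩, rfl⟩
        exact ⟨(d', i'), ⟨h₁, h₂⟩, rfl⟩
    rw [himg] at hg
    obtain ⟨b, hb, rfl⟩ := exists_coeff_of_mem_span_image hg
    exact ⟨a, b, ha, hb, hfg⟩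
  choose a b ha hb hab using hcoeff
  -- Lexicographic order with the round as leading digit, so that all transmissions of earlier
  -- rounds come earlier.
  let idx : Fin (D * Fintype.card I) ≃ Fin D × I :=
    finProdFinEquiv.symm.trans (Equiv.prodCongr (Equiv.refl _) (Fintype.equivFin I).symm)
  have hidx : ∀ r s, (idx r).1 < (idx s).1 → r < s := by
    intro r s hrs
    by_contra hle
    exact absurd (Nat.div_le_div_right (c := Fintype.card I) (Fin.le_def.1 (not_lt.1 hle)))
      (not_le.2 hrs)
  have hsym := roundCode_symbol (hidx := hidx) (ha := ha) (hb := hb) (L := fun y => L y.1 y.2) hab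
  have hinj : ∀ t (w w' : (j : Fin m) → Fin (len j) → ZMod 2),
      (roundCode len edgeOf idx hidx a b ha hb).received t w =
        (roundCode len edgeOf idx hidx a b ha hb).received t w' → w = w' := by
    intro t w w' hww
    by_contra hne
    obtain ⟨f, hf, hfw⟩ := hvis t (w - w') (sub_ne_zero.2 hne)
    refine hfw ?_
    rw [Module.Dual.eval_apply, map_sub, sub_eq_zero]
    -- If `w` and `w'` look the same at `t`, every generator of what `t` knows vanishes at `w - w'`,
    -- contrary to visibility.
    suffices knowledge tgt (sourceKnowledge G act len) L D (G.receiver t) ≤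
        LinearMap.ker (Module.Dual.eval (ZMod 2) _ (w - w')) by
      have := this hf
      rwa [LinearMap.mem_ker, Module.Dual.eval_apply, map_sub, sub_eq_zero] at this
    refine sup_le (Submodule.span_le.2 ?_) (Submodule.span_le.2 ?_)
    · rintro _ ⟨x, hx, rfl⟩
      rw [SetLike.mem_coe, LinearMap.mem_ker, Module.Dual.eval_apply, map_sub, sub_eq_zero]
      exact congrFun hww (Sum.inr ⟨⟨x.1, hx⟩, x.2⟩)
    · rintro _ ⟨⟨d, i⟩, ⟨hd, ht⟩, rfl⟩
      rw [SetLike.mem_coe, LinearMap.mem_ker, Module.Dual.eval_apply, map_sub, sub_eq_zero]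
      have hs : idx (idx.symm (⟨d, hd⟩, i)) = (⟨d, hd⟩, i) := idx.apply_symm_apply _
      have h₁ := congrFun hww (Sum.inl ⟨idx.symm (⟨d, hd⟩, i), by
        change G.tgt (edgeOf (idx (idx.symm (⟨d, hd⟩, i))).2) = _
        rw [hs]
        exact ht⟩)
      have h₂ := (hsym w (idx.symm (⟨d, hd⟩, i))).symm.trans (h₁.trans (hsym w' _))
      rwa [hs] at h₂
  refine ⟨roundCode len edgeOf idx hidx a b ha hb, fun j => ?_, roundCode_edgeBits,
    fun t w w' => hinj t w w'⟩
  change Nat.card (Fin (len j) → ZMod 2) = _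
  simp

open Classical in
-- The summand factors over the sources. A factor sums to at most `2`: one for the zero word and at
-- most one for the others.
lemma sum_pow_support_le (len : Fin m → ℕ) :
    ∑ w : (j : Fin m) → Fin (len j) → ZMod 2,
      (1 / 2 : ℝ) ^ ∑ j ∈ univ.filter (fun j => w j ≠ 0), len j ≤ 2 ^ m := by
  have h₁ : ∀ w : (j : Fin m) → Fin (len j) → ZMod 2,
      (1 / 2 : ℝ) ^ ∑ j ∈ univ.filter (fun j => w j ≠ 0), len j =
      ∏ j, if w j ≠ 0 then (1 / 2 : ℝ) ^ len j else 1 := by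
    intro w
    rw [← prod_pow_eq_pow_sum, prod_filter]
  simp only [h₁]
  rw [← Fintype.prod_sum
    (f := fun j (x : Fin (len j) → ZMod 2) => if x ≠ 0 then (1 / 2 : ℝ) ^ len j else 1)]
  refine (prod_le_prod (fun j _ => sum_nonneg fun x _ => by split_ifs <;> positivity)
    (g := fun _ => (2 : ℝ)) fun j _ => ?_).trans (by simp)
  calc ∑ x : Fin (len j) → ZMod 2, (if x ≠ 0 then (1 / 2 : ℝ) ^ len j else 1)
      ≤ ∑ x : Fin (len j) → ZMod 2, ((1 / 2 : ℝ) ^ len j + if x = 0 then 1 else 0) :=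
        sum_le_sum fun x _ => by by_cases hx : x = 0 <;> simp [hx]
    _ = 2 := by
        rw [sum_add_distrib, sum_const, sum_ite_eq' univ]
        simp only [mem_univ, if_true, card_univ, Fintype.card_fun, ZMod.card, Fintype.card_fin,
          nsmul_eq_mul]
        push_cast
        rw [← mul_pow]
        norm_num

/-- Multicast of independent symbols over a network by random linear coding. -/
theorem exists_multicast_code [Fintype E] (G : Network V E n T) (act : Fin m ↪ Fin n)
    (len : Fin m → ℕ) (u : E → ℕ) {D : ℕ} (hD : Fintype.card E < D)
    (hcut : ∀ A : Finset (Fin m), A.Nonempty → (∀ j ∈ A, len j ≠ 0) → ∀ (t : Fin T) (W : Set V),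
      (∀ j ∈ A, G.source (act j) ∈ W) → G.receiver t ∉ W →
        ∑ j ∈ A, len j + (T + D + m) ≤
          (D - Fintype.card E) * ∑ e, {e | G.src e ∈ W ∧ G.tgt e ∉ W}.indicator u e) :
    ∃ C : LinearNetworkCode G act, (∀ j, Nat.card (Fin (C.len j) → C.F) = 2 ^ len j) ∧
      (∀ e, C.edgeBits e = D * u e) ∧ ∀ t, Function.Injective (C.received t) := by
  classical
  set ν := Fintype.card E with hν
  set cut : Set V → ℕ := fun W => ∑ e, {e | G.src e ∈ W ∧ G.tgt e ∉ W}.indicator u e with hcutdef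
  let src : (Σ e : E, Fin (u e)) → V := fun i => G.src i.1
  let tgt : (Σ e : E, Fin (u e)) → V := fun i => G.tgt i.1
  have hleaving : ∀ W, (leaving src tgt W).card = cut W := by
    intro W
    rw [leaving, card_filter, Fintype.sum_sigma]
    refine sum_congr rfl fun e _ => ?_
    by_cases he : G.src e ∈ W ∧ G.tgt e ∉ W <;> simp [src, tgt, he]
  have hdeficit : ∀ W, deficit tgt W ≤ ν := by
    intro W
    refine (card_filter_le _ _).trans (le_trans (card_le_card (t := univ.image G.tgt) ?_)
      (card_image_le.trans card_univ.le))
    intro v hv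
    obtain ⟨i, -, rfl⟩ := mem_image.1 hv
    exact mem_image_of_mem _ (mem_univ i.1)
  set supp : ((j : Fin m) → Fin (len j) → ZMod 2) → Finset (Fin m) :=
    fun w => univ.filter fun j => w j ≠ 0 with hsupp
  -- `θ` is `2 ^ (-mincut)` for the sources at which `w` is non-zero. If no set separates them from
  -- the receiver, any small positive value will do. The extra exponent `T + D + m` pays for the
  -- receivers, the factor `2 ^ D` and the sum over `w`.
  have hθ : ∀ p : {w : (j : Fin m) → Fin (len j) → ZMod 2 // w ≠ 0} × Fin T, ∃ θ : ℝ,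
      0 < θ ∧ θ ≤ 1 ∧ (∀ W : Set V, (∀ j ∈ supp p.1, G.source (act j) ∈ W) →
        G.receiver p.2 ∉ W → (1 / 2 : ℝ) ^ cut W ≤ θ) ∧
      θ ^ (D - ν) ≤ (1 / 2) ^ (∑ j ∈ supp p.1, len j + (T + D + m)) := by
    rintro ⟨⟨w, hw⟩, t⟩
    have hne : (supp w).Nonempty := by
      obtain ⟨j, hj⟩ := Function.ne_iff.1 hw
      exact ⟨j, by simpa [hsupp] using hj⟩
    have hpos : ∀ j ∈ supp w, len j ≠ 0 := by
      intro j hj h0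
      obtain ⟨l, -⟩ := Function.ne_iff.1 (mem_filter.1 hj).2
      exact absurd l.2 (by omega)
    by_cases hex : ∃ c, ∃ W : Set V, (∀ j ∈ supp w, G.source (act j) ∈ W) ∧
        G.receiver t ∉ W ∧ cut W = c
    · obtain ⟨W, hW, htW, hc⟩ := Nat.find_spec hex
      refine ⟨(1 / 2) ^ cut W, by positivity, pow_le_one₀ (by norm_num) (by norm_num),
        fun W' hW' htW' => ?_, ?_⟩
      · exact pow_le_pow_of_le_one (by norm_num) (by norm_num)
          (hc.trans_le (Nat.find_min' hex ⟨W', hW', htW', rfl⟩))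
      · rw [← pow_mul, mul_comm]
        exact pow_le_pow_of_le_one (by norm_num) (by norm_num) (hcut _ hne hpos t W hW htW)
    · refine ⟨(1 / 2) ^ (∑ j ∈ supp w, len j + (T + D + m)), by positivity,
        pow_le_one₀ (by norm_num) (by norm_num),
        fun W hW htW => absurd ⟨_, W, hW, htW, rfl⟩ hex, ?_⟩
      exact pow_le_of_le_one (by positivity) (pow_le_one₀ (by norm_num) (by norm_num)) (by omega)
  choose θ hθ₀ hθ₁ hθcut hθD using hθ
  -- Of the `D` factors `θ`, `ν` cancel the denominator `θ ^ deficit`; the other `D - ν` are bounded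
  -- by the cut condition.
  have hbound : ∀ p W, failureBound tgt (θ p) D (G.receiver p.2) W ≤
      2 ^ D * (1 / 2) ^ (T + D + m) * (1 / 2) ^ ∑ j ∈ supp p.1, len j := by
    intro p W
    rw [failureBound]
    split_ifs
    · positivity
    · have h₁ : θ p ^ D = θ p ^ (D - ν) * θ p ^ ν := by rw [← pow_add]; congr 1; omega
      have h₀ := hθ₀ p
      have h₂ : θ p ^ ν ≤ θ p ^ deficit tgt W :=
        pow_le_pow_of_le_one (hθ₀ p).le (hθ₁ p) (hdeficit W)
      rw [div_le_iff₀ (pow_pos (hθ₀ p) _), h₁]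
      calc 2 ^ D * (θ p ^ (D - ν) * θ p ^ ν)
          ≤ 2 ^ D * ((1 / 2) ^ (∑ j ∈ supp p.1, len j + (T + D + m)) * θ p ^ deficit tgt W) := by
            have := hθD p
            gcongr
        _ = _ := by rw [pow_add]; ring
  have hsum := sum_pow_support_le len
  have htotal : ∑ p : {w : (j : Fin m) → Fin (len j) → ZMod 2 // w ≠ 0} × Fin T,
      failureBound tgt (θ p) D (G.receiver p.2) (visible (sourceKnowledge G act len)
        (Module.Dual.eval (ZMod 2) _ p.1.1)) < 1 := by
    calc _ ≤ ∑ p : {w : (j : Fin m) → Fin (len j) → ZMod 2 // w ≠ 0} × Fin T,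
          2 ^ D * (1 / 2 : ℝ) ^ (T + D + m) * (1 / 2) ^ ∑ j ∈ supp p.1, len j :=
          sum_le_sum fun p _ => hbound p _
      _ = T * (2 ^ D * (1 / 2 : ℝ) ^ (T + D + m)) *
          ∑ w : {w : (j : Fin m) → Fin (len j) → ZMod 2 // w ≠ 0},
            (1 / 2 : ℝ) ^ ∑ j ∈ supp w, len j := by
          rw [Fintype.sum_prod_type]
          simp only [sum_const, card_univ, Fintype.card_fin, nsmul_eq_mul, mul_sum]
          exact sum_congr rfl fun w _ => by ring
      _ ≤ T * (2 ^ D * (1 / 2 : ℝ) ^ (T + D + m)) * 2 ^ m := by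
          gcongr
          refine le_trans ?_ hsum
          rw [← sum_subtype (univ.filter fun w : (j : Fin m) → Fin (len j) → ZMod 2 => w ≠ 0)
            (p := fun w => w ≠ 0) (by simp) fun w => (1 / 2 : ℝ) ^ ∑ j ∈ supp w, len j]
          exact sum_le_sum_of_subset_of_nonneg (subset_univ _) fun _ _ _ => by positivity
      _ = T / 2 ^ T := by
          rw [pow_add, pow_add, one_div, inv_pow, inv_pow, inv_pow]
          field_simp
      _ < 1 := by
          rw [div_lt_one (by positivity)]
          exact_mod_cast Nat.lt_two_pow_self
  have : Finite (Module.Dual (ZMod 2) ((j : Fin m) → Fin (len j) → ZMod 2)) :=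
    Finite.of_injective (fun f => (f : _ → ZMod 2)) DFunLike.coe_injective
  obtain ⟨L, hL, hvis⟩ := exists_transmissions (src := src) (sourceKnowledge G act len)
    (fun p : {w : (j : Fin m) → Fin (len j) → ZMod 2 // w ≠ 0} × Fin T =>
      Module.Dual.eval (ZMod 2) _ p.1.1) (fun p => G.receiver p.2) θ hθ₀ hθ₁
    (fun p W hW ht => by
      rw [hleaving]
      exact hθcut p W (fun j hj => hW (mem_visible_sourceKnowledge G act len
        (mem_filter.1 hj).2)) ht) D htotal
  obtain ⟨C, h₁, h₂, h₃⟩ := exists_code_of_transmissions G act len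
    (fun i : Σ e : E, Fin (u e) => i.1) D L hL fun t w hw => hvis (⟨w, hw⟩, t)
  refine ⟨C, h₁, fun e => ?_, h₃⟩
  rw [h₂, Nat.card_congr (Equiv.sigmaSubtype e)]
  simp

end Realization

/-! ### Rates inside the cut-set region -/

section Achievability

open Finset Filter Topology

lemma natEntropy_eq {α : Type*} (q : PMF α) : natEntropy q = entropy q * Real.log 2 := by
  rw [entropy, natEntropy, div_mul_cancel₀ _ (Real.log_pos one_lt_two).ne']

lemma entropy_nonneg {α : Type*} (q : PMF α) : 0 ≤ entropy q :=
  div_nonneg (natEntropy_nonneg q) (Real.log_pos one_lt_two).le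

lemma indepBlockMass_eq {n m : ℕ} (p : PMF (Fin n → ℝ)) (act : Fin m ↪ Fin n) (N : ℕ) :
    indepBlockMass p act N = iidMass (indepPMF fun j => sourceLaw p (act j)) N := rfl

lemma blockMass_eq {n : ℕ} (p : PMF (Fin n → ℝ)) (N : ℕ) : blockMass p N = iidMass p N := rfl

/-- Union bound over the coordinates of a vector source. -/
lemma massOf_exists_le {β α : Type*} {m N : ℕ} (P : PMF β) (f : Fin m → β → α)
    {B : Fin m → Set (Fin N → α)} {c : ℝ≥0∞}
    (hB : ∀ j, massOf (iidMass (P.map (f j)) N) (B j) ≤ c) :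
    massOf (iidMass P N) {x | ∃ j, (fun τ => f j (x τ)) ∈ B j} ≤ m * c := by
  have h : {x : Fin N → β | ∃ j, (fun τ => f j (x τ)) ∈ B j} =
      ⋃ j, {x | (fun τ => f j (x τ)) ∈ B j} := by
    ext; simp
  rw [h]
  refine (massOf_iUnion_le _ _).trans ((sum_le_sum fun j _ =>
    (iidMass_map P (f j) N (B j)).trans_le (hB j)).trans ?_)
  simp

variable {V E : Type*} {n T m k N : ℕ} {G : Network V E n T} {act : Fin m ↪ Fin n}

/-- Correct active messages are measurements of the sparse vector by the active rows. Every correct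
`L¹` solver must return that vector, so the choice of the modular decoder is immaterial. -/
lemma SDCICCode.notMem_sourceError {C : SDCICCode G act N} {p : PMF (Fin n → ℝ)}
    {Φ : Matrix (Fin n) (Fin n) ℝ} (hk : 1 ≤ k) (hkn : k ≤ n)
    (hp : SparselyCorrelated p Φ k act) (D : (t : Fin T) → C.Decoder t) {x : Fin N → Fin n → ℝ}
    (hx : iidMass p N x ≠ 0) (hnet : (fun τ j => x τ (act j)) ∉ C.networkError) :
    x ∉ C.sourceError Φ k D := by
  rintro ⟨t, τ, hne⟩
  refine hne ?_
  have hsupp : x τ ∈ p.support := by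
    rw [PMF.mem_support_iff]
    exact Finset.prod_ne_zero_iff.1 hx τ (mem_univ τ)
  obtain ⟨z, hz, hxz⟩ := hp.sparse _ hsupp
  have hdec : C.dec t (C.receivedFrom t fun τ j => x τ (act j)) = fun τ j => x τ (act j) := by
    by_contra h
    exact hnet ⟨t, h⟩
  have hy : (fun j => x τ (act j)) = (activeRows Φ act).mulVec z := by
    ext j
    rw [hxz]
    rfl
  have hout : (D t).output Φ x τ = z := by
    rw [(D t).output_eq, congrFun hdec τ]
    refine IsL1Minimizer.eq_of_isSparse hk hkn hp.rip hz ?_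
    rw [← hy]
    exact (D t).cs_correct _ _ ⟨z, hy.symm⟩
  rw [hout]
  exact ⟨hz, hxz.symm⟩

/-- Source coding followed by a network code in which every receiver can decode. -/
lemma LinearNetworkCode.exists_sdcicCode (C₀ : LinearNetworkCode G act)
    (hinj : ∀ t, Function.Injective (C₀.received t)) (S : Fin m → Finset (Fin N → ℝ))
    (hS : ∀ j, (S j).card ≤ Nat.card (Fin (C₀.len j) → C₀.F)) :
    ∃ C : SDCICCode G act N, C.toLinearNetworkCode = C₀ ∧
      ∀ y, (∀ j, (fun τ => y τ j) ∈ S j) → y ∉ C.networkError := by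
  classical
  have hemb : ∀ j, ∃ f : (Fin N → ℝ) → Fin (C₀.len j) → C₀.F, Set.InjOn f (S j) := by
    intro j
    have h₁ : Fintype.card (S j) ≤ Fintype.card (Fin (C₀.len j) → C₀.F) := by
      rw [Fintype.card_coe, ← Nat.card_eq_fintype_card]
      exact hS j
    obtain ⟨f⟩ := Function.Embedding.nonempty_of_card_le h₁
    refine ⟨fun x => if h : x ∈ S j then f ⟨x, h⟩ else 0, fun x hx x' hx' h => ?_⟩
    simp only [Finset.mem_coe] at hx hx'
    simpa [hx, hx'] using h
  choose enc henc using hemb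
  let rcv : (t : Fin T) → (Fin N → Fin m → ℝ) → C₀.Received t → C₀.F :=
    fun t y => C₀.received t fun j => enc j fun τ => y τ j
  let good : Set (Fin N → Fin m → ℝ) := {y | ∀ j, (fun τ => y τ j) ∈ S j}
  have hrcv : ∀ t, Set.InjOn (rcv t) good := by
    intro t y hy y' hy' h
    have h₁ := hinj t h
    ext τ j
    exact congrFun (henc j (hy j) (hy' j) (congrFun h₁ j)) τ
  let label : C₀.F ↪ ℝ :=
    (Fintype.equivFin C₀.F).toEmbedding.trans ⟨fun i => ((i : ℕ) : ℝ), fun i i' h => by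
      simpa [Fin.ext_iff] using h⟩
  refine ⟨{ C₀ with
      enc := enc
      label := label
      dec := fun t => Function.invFunOn (rcv t) good }, rfl, ?_⟩
  rintro y hy ⟨t, hne⟩
  exact hne ((hrcv t).leftInvOn_invFunOn hy)

lemma le_cutCapacity_of_le_minCut [Fintype E] {A : Finset (Fin m)} {t : Fin T} {x : ℝ}
    (h : ENNReal.ofReal x ≤ G.minCut act A t) {W : Set V}
    (hW : ∀ j ∈ A, G.source (act j) ∈ W) (ht : G.receiver t ∉ W) : x ≤ G.cutCapacity W := by
  have h₁ : ENNReal.ofReal x ≤ (G.cutCapacity W : ℝ≥0∞) := h.trans (iInf₂_le W ⟨hW, ht⟩)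
  rw [← ENNReal.ofReal_coe_nnreal] at h₁
  exact (ENNReal.ofReal_le_ofReal_iff (G.cutCapacity W).2).1 h₁

open Classical in
/-- The edges that leave the set of nodes `W`. -/
noncomputable def Network.cutEdges [Fintype E] (G : Network V E n T) (W : Set V) : Finset E :=
  univ.filter fun e => G.src e ∈ W ∧ G.tgt e ∉ W

lemma Network.sum_indicator_eq [Fintype E] {R : Type*} [AddCommMonoid R] (G : Network V E n T)
    (W : Set V) (f : E → R) :
    ∑ e, {e | G.src e ∈ W ∧ G.tgt e ∉ W}.indicator f e = ∑ e ∈ G.cutEdges W, f e := by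
  classical
  rw [cutEdges, sum_filter]
  refine sum_congr rfl fun e _ => ?_
  rw [Set.indicator_apply]
  congr!

lemma Network.coe_cutCapacity [Fintype E] (G : Network V E n T) (W : Set V) :
    (G.cutCapacity W : ℝ) = ∑ e ∈ G.cutEdges W, (G.cap e : ℝ) := by
  rw [cutCapacity, G.sum_indicator_eq, NNReal.coe_sum]

/-- Rounding to whole symbols and rounds costs little for large block lengths. -/
lemma rounded_rates_le {E J : Type*} {ν m D : ℕ} (F : Finset E) (hF : F.card ≤ ν)
    (hFne : F.Nonempty) (A : Finset J) (hA : A.card ≤ m) (cap : E → ℝ)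
    (h : J → ℝ) {η δ N Q : ℝ} (hη : 0 < η) (hδ : 0 ≤ δ) (hh : ∀ j ∈ A, 0 ≤ h j)
    (hN : 0 ≤ N) (hD : ν < D) (hle : ∑ j ∈ A, h j ≤ ∑ e ∈ F, cap e) (hδm : 4 * (m * δ) ≤ η)
    (hDη : 4 * (ν * ∑ e ∈ F, (cap e + η)) ≤ η * D) (hQ : m + Q + D * ν ≤ N * η / 2) :
    ∑ j ∈ A, (⌈N * (h j + δ)⌉₊ : ℝ) + Q ≤
      (D - ν : ℝ) * ∑ e ∈ F, (⌊N * (cap e + η) / D⌋₊ : ℝ) := by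
  have hD0 : (0 : ℝ) < D := by exact_mod_cast (Nat.zero_le ν).trans_lt hD
  have hDν : (0 : ℝ) ≤ D - ν := sub_nonneg.2 (by exact_mod_cast hD.le)
  set c := ∑ e ∈ F, cap e with hc
  set S := ∑ e ∈ F, (cap e + η) with hS
  -- One cut edge already provides the slack `η`: a quarter covers `δ`, a quarter the delay `ν / D`,
  -- and half the rounding and `Q`.
  have hScη : c + η ≤ S := by
    rw [hS, sum_add_distrib, sum_const, nsmul_eq_mul]
    have : (1 : ℝ) ≤ F.card := by exact_mod_cast hFne.card_pos
    nlinarith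
  have h₁ : ∑ j ∈ A, (⌈N * (h j + δ)⌉₊ : ℝ) ≤ N * (c + η / 4) + m := by
    have hAm : (A.card : ℝ) ≤ m := by exact_mod_cast hA
    calc ∑ j ∈ A, (⌈N * (h j + δ)⌉₊ : ℝ) ≤ ∑ j ∈ A, (N * (h j + δ) + 1) :=
          sum_le_sum fun j hj =>
            (Nat.ceil_lt_add_one (mul_nonneg hN (add_nonneg (hh j hj) hδ))).le
      _ = N * (∑ j ∈ A, h j + A.card * δ) + A.card := by
          rw [sum_add_distrib, ← mul_sum, sum_add_distrib]
          simp
      _ ≤ N * (c + m * δ) + m := by gcongr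
      _ ≤ N * (c + η / 4) + m := by
          have : m * δ ≤ η / 4 := by linarith
          gcongr
  have h₂ : N * S / D - ν ≤ ∑ e ∈ F, (⌊N * (cap e + η) / D⌋₊ : ℝ) := by
    have hFν : (F.card : ℝ) ≤ ν := by exact_mod_cast hF
    calc N * S / D - ν ≤ N * S / D - F.card := by linarith
      _ = ∑ e ∈ F, (N * (cap e + η) / D - 1) := by
          rw [sum_sub_distrib, hS, mul_sum, sum_div]
          simp
      _ ≤ _ := sum_le_sum fun e _ => (Nat.sub_one_lt_floor _).le
  have h₃ : (D - ν : ℝ) * (N * S / D - ν) ≤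
      (D - ν : ℝ) * ∑ e ∈ F, (⌊N * (cap e + η) / D⌋₊ : ℝ) := by gcongr
  refine le_trans ?_ h₃
  have h₄ : (D - ν : ℝ) * (N * S / D - ν) = N * S - N * (ν * S / D) - D * ν + (ν : ℝ) * ν := by
    field_simp
    ring
  have h₅ : ν * S / D ≤ η / 4 := by
    rw [div_le_div_iff₀ hD0 (by norm_num)]
    linarith
  have h₆ : N * (ν * S / D) ≤ N * (η / 4) := by gcongr
  have h₇ : N * (c + η) ≤ N * S := by gcongr
  have h₈ : (0 : ℝ) ≤ (ν : ℝ) * ν := by positivity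
  rw [h₄]
  linarith

/-- Achievability: rates inside the cut-set region are supported. -/
theorem supportsSDCIC_of_le_minCut [Fintype E] {p : PMF (Fin n → ℝ)}
    {Φ : Matrix (Fin n) (Fin n) ℝ} (hk : 1 ≤ k) (hkn : k ≤ n)
    (hp : SparselyCorrelated p Φ k act) (hH : ∀ j, FiniteEntropy (sourceLaw p (act j)))
    (hcut : ∀ t, ∀ A : Finset (Fin m),
      ENNReal.ofReal (∑ j ∈ A, entropy (sourceLaw p (act j))) ≤ G.minCut act A t) :
    SupportsSDCIC G p Φ k act := by
  classical
  intro η hη ε hε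
  set h : Fin m → ℝ := fun j => entropy (sourceLaw p (act j)) with hh
  set ν := Fintype.card E with hν
  -- `D` is fixed before `N`; it makes the loss of `ν` rounds out of `D` at most `η / 4` per unit of
  -- time.
  obtain ⟨D, hD⟩ := exists_nat_gt (max (ν : ℝ) (4 * (ν * ∑ e, ((G.cap e : ℝ) + η)) / η))
  have hDν : ν < D := by exact_mod_cast (le_max_left _ _).trans_lt hD
  have hDη : 4 * (ν * ∑ e, ((G.cap e : ℝ) + η)) ≤ η * D := by
    have := (le_max_right _ _).trans_lt hD
    rw [div_lt_iff₀ hη] at this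
    linarith
  have hD0 : (0 : ℝ) < D := by exact_mod_cast (Nat.zero_le ν).trans_lt hDν
  set δ : ℝ := η / (4 * (m + 1)) with hδdef
  have hδ : 0 < δ := by positivity
  have hδm : 4 * (m * δ) ≤ η := by
    have : η = 4 * ((m + 1) * δ) := by rw [hδdef]; field_simp
    linarith
  have hlog := Real.log_pos one_lt_two
  set c : ℝ≥0∞ := ENNReal.ofReal (ε / (m + 1)) with hc
  have hc0 : 0 < c := ENNReal.ofReal_pos.2 (by positivity)
  have hmc : m * c ≤ ENNReal.ofReal ε := by
    rw [hc, ← ENNReal.ofReal_natCast, ← ENNReal.ofReal_mul (by positivity)]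
    refine ENNReal.ofReal_le_ofReal ?_
    rw [mul_div_assoc', div_le_iff₀ (by positivity)]
    nlinarith
  filter_upwards [eventually_all.2 fun j =>
      eventually_exists_typical_finset (hH j) (mul_pos hδ hlog) hc0,
    eventually_ge_atTop ⌈(m + ((T + D + m : ℕ) : ℝ) + D * ν) * 2 / η⌉₊] with N hS hN
  choose S hSmass hScard hSzero using hS
  have hNη : m + ((T + D + m : ℕ) : ℝ) + D * ν ≤ N * η / 2 := by
    have := Nat.ceil_le.1 hN
    rw [div_le_iff₀ hη] at this
    linarith
  -- A source of zero entropy gets no bits, since the slack `η` per edge is of no use on a cut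
  -- without edges. For the other sources, the cut condition forces a crossing edge.
  set len : Fin m → ℕ := fun j => if h j = 0 then 0 else ⌈(N : ℝ) * (h j + δ)⌉₊ with hlen
  set u : E → ℕ := fun e => ⌊(N : ℝ) * (G.cap e + η) / D⌋₊ with hu
  obtain ⟨C₀, hcard, hbits, hinj⟩ := exists_multicast_code G act len u hDν (by
    intro A hA hlenA t W hW ht
    have hpos : ∀ j ∈ A, h j ≠ 0 := fun j hj h0 => hlenA j hj (if_pos h0)
    have hle := le_cutCapacity_of_le_minCut (hcut t A) hW ht
    rw [G.coe_cutCapacity] at hle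
    have hFne : (G.cutEdges W).Nonempty := by
      by_contra hne
      rw [not_nonempty_iff_eq_empty] at hne
      rw [hne, sum_empty] at hle
      obtain ⟨j, hj⟩ := hA
      have hz := (sum_eq_zero_iff_of_nonneg fun j _ => entropy_nonneg _).1
        (le_antisymm hle (sum_nonneg fun j _ => entropy_nonneg _)) j hj
      exact hpos j hj hz
    have key := rounded_rates_le (ν := ν) (m := m) (D := D) (G.cutEdges W) (card_le_univ _) hFne A
      (by simpa using card_le_univ A) (fun e => (G.cap e : ℝ)) h
      (N := N) (Q := ((T + D + m : ℕ) : ℝ)) hη hδ.le (fun j _ => entropy_nonneg _)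
      (Nat.cast_nonneg N) hDν hle hδm (le_trans (by
        gcongr
        exact subset_univ _) hDη) hNη
    rw [G.sum_indicator_eq, ← Nat.cast_le (α := ℝ), Nat.cast_mul, Nat.cast_sub hDν.le,
      Nat.cast_add, Nat.cast_sum, Nat.cast_sum]
    refine le_trans (le_of_eq ?_) key
    congr 1
    exact sum_congr rfl fun j hj => by simp only [hlen, if_neg (hpos j hj)])
  have hSlen : ∀ j, (S j).card ≤ 2 ^ len j := by
    intro j
    by_cases h0 : h j = 0
    · have : natEntropy (sourceLaw p (act j)) = 0 := by
        rw [natEntropy_eq]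
        exact mul_eq_zero_of_left h0 _
      simpa [hlen, h0] using hSzero j this
    · have h₁ := hScard j
      rw [← Nat.cast_le (α := ℝ)]
      refine h₁.trans ?_
      have h₂ : (N : ℝ) * (natEntropy (sourceLaw p (act j)) + δ * Real.log 2) =
          Real.log 2 * (N * (h j + δ)) := by
        rw [natEntropy_eq]
        ring
      rw [h₂, Real.exp_mul, Real.exp_log two_pos]
      push_cast
      rw [← Real.rpow_natCast]
      refine Real.rpow_le_rpow_of_exponent_le one_le_two ?_
      simp only [hlen, if_neg h0]
      exact Nat.le_ceil _
  obtain ⟨C, rfl, hC⟩ := C₀.exists_sdcicCode hinj S fun j => (hSlen j).trans (hcard j).ge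
  refine ⟨C, fun e => ?_, ?_, fun Dec => ?_⟩
  · rw [hbits]
    have : (u e : ℝ) ≤ N * (G.cap e + η) / D := Nat.floor_le (by positivity)
    rw [le_div_iff₀ hD0] at this
    linarith
  · rw [indepBlockMass_eq]
    refine le_trans (massOf_mono fun y hy _ => ?_)
      ((massOf_exists_le (indepPMF fun j => sourceLaw p (act j)) (fun j y => y j)
        (B := fun j => (S j : Set (Fin N → ℝ))ᶜ) (c := c) fun j => ?_).trans hmc)
    · by_contra hne
      refine hC y (fun j => ?_) hy
      by_contra hj
      exact hne ⟨j, hj⟩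
    · rw [indepPMF_map_eval]
      exact hSmass j
  · rw [blockMass_eq]
    refine le_trans (massOf_mono fun x hx hx0 => ?_)
      ((massOf_exists_le p (fun j μ => μ (act j))
        (B := fun j => (S j : Set (Fin N → ℝ))ᶜ) (c := c) fun j => hSmass j).trans hmc)
    by_contra hne
    refine C.notMem_sourceError hk hkn hp Dec hx0 (hC _ fun j => ?_) hx
    by_contra hj
    exact hne ⟨j, hj⟩

end Achievability

/-! ### Rates outside the cut-set region -/

section Converse

open Finset Filter Topology

variable {V E : Type*} {n T m k N : ℕ} {G : Network V E n T} {act : Fin m ↪ Fin n}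

/-- What is sent to nodes outside `W` is determined by the sources outside `W` and the symbols that
leave `W`. -/
lemma LinearNetworkCode.symbol_congr_of_cut (C : LinearNetworkCode G act) {W : Set V}
    {w w' : (j : Fin m) → Fin (C.len j) → C.F} (hsrc : ∀ j, G.source (act j) ∉ W → w j = w' j)
    (hcut : ∀ s, G.src (C.edge s) ∈ W → G.tgt (C.edge s) ∉ W → C.symbol w s = C.symbol w' s)
    (s : Fin C.K) (hs : G.tgt (C.edge s) ∉ W) : C.symbol w s = C.symbol w' s := by
  induction s using WellFoundedLT.induction with
  | _ s ih =>
    by_cases hsW : G.src (C.edge s) ∈ W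
    · exact hcut s hsW hs
    · rw [C.symbol_eq, C.symbol_eq]
      congr 1
      · refine sum_congr rfl fun j _ => sum_congr rfl fun l _ => ?_
        by_cases h0 : C.srcCoeff s j l = 0
        · rw [h0, zero_mul, zero_mul]
        · rw [hsrc j (by rwa [C.src_local s j l h0])]
      · refine sum_congr rfl fun r _ => ?_
        by_cases h0 : C.relayCoeff s r = 0
        · rw [h0, zero_mul, zero_mul]
        · rw [ih r.1 r.2 (by rwa [(C.relay_local s r h0).2])]

lemma LinearNetworkCode.received_congr_of_cut (C : LinearNetworkCode G act) {W : Set V}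
    {w w' : (j : Fin m) → Fin (C.len j) → C.F} (hsrc : ∀ j, G.source (act j) ∉ W → w j = w' j)
    (hcut : ∀ s, G.src (C.edge s) ∈ W → G.tgt (C.edge s) ∉ W → C.symbol w s = C.symbol w' s)
    {t : Fin T} (ht : G.receiver t ∉ W) : C.received t w = C.received t w' := by
  funext a
  rcases a with s | a
  · exact C.symbol_congr_of_cut hsrc hcut s.1 (by rwa [s.2])
  · exact congrFun (hsrc a.1.1 (by rwa [a.1.2])) a.2

/-- Names of the symbols that leave `W`. -/
abbrev LinearNetworkCode.CutSymbol (C : LinearNetworkCode G act) (W : Set V) : Type :=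
  {s : Fin C.K // G.src (C.edge s) ∈ W ∧ G.tgt (C.edge s) ∉ W}

/-- The number of values that the symbols leaving `W` can take. -/
lemma LinearNetworkCode.card_cutSymbol [Fintype E] (C : LinearNetworkCode G act) (W : Set V) :
    (Nat.card (C.CutSymbol W → C.F) : ℝ) = 2 ^ ∑ e ∈ G.cutEdges W, C.edgeBits e := by
  classical
  have hF : (0 : ℝ) < Fintype.card C.F := by exact_mod_cast Fintype.card_pos
  have h₁ : Nat.card (C.CutSymbol W) =
      ∑ e ∈ G.cutEdges W, Nat.card {s : Fin C.K // C.edge s = e} := by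
    rw [Nat.card_eq_fintype_card, Fintype.card_subtype,
      card_eq_sum_card_fiberwise (f := C.edge) (t := G.cutEdges W) fun s hs => by
        simpa [Network.cutEdges] using hs]
    refine sum_congr rfl fun e he => ?_
    rw [Nat.card_eq_fintype_card, Fintype.card_subtype, filter_filter]
    congr 1
    refine filter_congr fun s _ => ⟨fun h => h.2, fun h => ⟨?_, h⟩⟩
    rw [h]
    simpa [Network.cutEdges] using he
  simp only [LinearNetworkCode.edgeBits]
  rw [← sum_mul, mul_comm, Real.rpow_mul zero_le_two,
    Real.rpow_logb two_pos (by norm_num) hF, ← Nat.cast_sum, ← h₁, Real.rpow_natCast, Nat.card_fun,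
    Nat.card_eq_fintype_card (α := C.F)]
  push_cast
  rfl

/-- The blocks that the receiver `t` decodes correctly and that are typical for all sources have
small probability if the symbols leaving `W` take few values. -/
lemma massOf_decoded_le (C : SDCICCode G act N) (q : Fin m → PMF ℝ) {A : Finset (Fin m)}
    {t : Fin T} {W : Set V} (hW : ∀ j ∈ A, G.source (act j) ∈ W) (ht : G.receiver t ∉ W)
    {R : Set (Fin N → Fin m → ℝ)} (hR : ∀ y ∈ R, y ∉ C.networkError) {b : Fin m → ℝ≥0∞}
    (hb : ∀ y ∈ R, ∀ j ∈ A, iidMass (q j) N (fun τ => y τ j) ≤ b j) :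
    massOf (iidMass (indepPMF q) N) R ≤ (∏ j ∈ A, b j) * Nat.card (C.CutSymbol W → C.F) := by
  classical
  -- A decodable block is determined by the symbols crossing the cut and the blocks of the sources
  -- not in `A`, because every source outside `W` is among these.
  let κ : R → (C.CutSymbol W → C.F) × ({j // j ∉ A} → Fin N → ℝ) := fun y =>
    (fun s => C.symbol (fun j => C.enc j fun τ => y.1 τ j) s.1, fun j τ => y.1 τ j.1)
  have hκ : Function.Injective κ := by
    intro y y' h
    have h₁ := congrArg Prod.fst h
    have h₂ := congrArg Prod.snd h
    have hdec : ∀ y : R, C.dec t (C.receivedFrom t y.1) = y.1 := fun y => by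
      by_contra hne
      exact hR y.1 y.2 ⟨t, hne⟩
    refine Subtype.ext ?_
    rw [← hdec y, ← hdec y']
    congr 1
    refine C.received_congr_of_cut (fun j hj => ?_) (fun s hs hs' => ?_) ht
    · have hjA : j ∉ A := fun hjA => hj (hW j hjA)
      exact congrArg (C.enc j) (congrFun h₂ ⟨j, hjA⟩)
    · exact congrFun h₁ ⟨s, hs, hs'⟩
  -- Summed over all blocks of the sources not in `A`, their masses give one, so only the number of
  -- cut values remains.
  let g : (C.CutSymbol W → C.F) × ({j // j ∉ A} → Fin N → ℝ) → ℝ≥0∞ := fun z =>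
    (∏ j ∈ A, b j) * ∏ j, iidMass (q j.1) N (z.2 j)
  have hle : ∀ y : R, iidMass (indepPMF q) N y.1 ≤ g (κ y) := by
    intro y
    have h₁ : iidMass (indepPMF q) N y.1 = ∏ j, iidMass (q j) N fun τ => y.1 τ j := by
      simp only [iidMass, indepPMF_apply]
      exact prod_comm
    rw [h₁, ← prod_mul_prod_compl A]
    refine mul_le_mul' (prod_le_prod' fun j hj => hb y.1 y.2 j hj) (le_of_eq ?_)
    exact prod_subtype Aᶜ (by simp) _
  calc massOf (iidMass (indepPMF q) N) R = ∑' y : R, iidMass (indepPMF q) N y.1 :=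
        (tsum_subtype R _).symm
    _ ≤ ∑' y : R, g (κ y) := ENNReal.tsum_le_tsum hle
    _ ≤ ∑' z, g z := ENNReal.tsum_comp_le_tsum_of_injective hκ g
    _ = (∏ j ∈ A, b j) * Nat.card (C.CutSymbol W → C.F) := by
        simp only [g]
        rw [ENNReal.tsum_mul_left, ENNReal.tsum_prod']
        simp only [ENNReal.tsum_pi_prod fun (j : {j // j ∉ A}) => iidMass (q j.1) N,
          tsum_iidMass, prod_const_one]
        rw [tsum_fintype, sum_const, card_univ, nsmul_one, Nat.card_eq_fintype_card]

/-- Converse: rates outside the cut-set region are not supported. -/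
theorem le_minCut_of_supportsSDCIC [Fintype E] {p : PMF (Fin n → ℝ)}
    {Φ : Matrix (Fin n) (Fin n) ℝ} (hH : ∀ j, FiniteEntropy (sourceLaw p (act j)))
    (hsupp : SupportsSDCIC G p Φ k act) (t : Fin T) (A : Finset (Fin m)) :
    ENNReal.ofReal (∑ j ∈ A, entropy (sourceLaw p (act j))) ≤ G.minCut act A t := by
  classical
  refine le_iInf₂ fun W hW => ?_
  obtain ⟨hW, ht⟩ := hW
  rw [← ENNReal.ofReal_coe_nnreal]
  refine ENNReal.ofReal_le_ofReal ?_
  by_contra hlt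
  push Not at hlt
  set q : Fin m → PMF ℝ := fun j => sourceLaw p (act j) with hq
  set ν := Fintype.card E with hν
  set γ : ℝ := ∑ j ∈ A, entropy (q j) - G.cutCapacity W with hγdef
  have hγ : 0 < γ := sub_pos.2 hlt
  -- Of the gap `γ`, the excess capacity and the typicality tolerance use a quarter each; the
  -- exponent `γ / 2` remains.
  set η : ℝ := γ / (4 * (ν + 1)) with hη
  set δ : ℝ := γ / (4 * (m + 1)) with hδ
  have hη0 : 0 < η := by positivity
  have hδ0 : 0 < δ := by positivity
  have hην : ν * η ≤ γ / 4 := by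
    have : γ = 4 * ((ν + 1) * η) := by rw [hη]; field_simp
    linarith
  have hδm : m * δ ≤ γ / 4 := by
    have : γ = 4 * ((m + 1) * δ) := by rw [hδ]; field_simp
    linarith
  have hlog := Real.log_pos one_lt_two
  set c : ℝ≥0∞ := ENNReal.ofReal (1 / (4 * (m + 1))) with hc
  have hc0 : 0 < c := ENNReal.ofReal_pos.2 (by positivity)
  have hmc : m * c ≤ ENNReal.ofReal (1 / 4) := by
    rw [hc, ← ENNReal.ofReal_natCast, ← ENNReal.ofReal_mul (by positivity)]
    refine ENNReal.ofReal_le_ofReal ?_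
    rw [mul_one_div, div_le_div_iff₀ (by positivity) (by norm_num)]
    linarith
  have hexp : Tendsto (fun N : ℕ => Real.exp (-(N * (γ / 2 * Real.log 2)))) atTop (𝓝 0) :=
    Real.tendsto_exp_neg_atTop_nhds_zero.comp
      (tendsto_natCast_atTop_atTop.atTop_mul_const (by positivity))
  obtain ⟨N, ⟨C, hbits, hrel⟩, hat, hN0, hNexp⟩ := ((hsupp η hη0 (1 / 4) (by norm_num)).and
    ((eventually_all.2 fun j =>
      eventually_massOf_atypical_le (hH j) (mul_pos hδ0 hlog) hc0).and
    ((eventually_gt_atTop 0).and (hexp.eventually (gt_mem_nhds (show (0 : ℝ) < 1 / 4 by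
      norm_num)))))).exists
  set w := iidMass (indepPMF q) N with hw
  set B₁ : Set (Fin N → Fin m → ℝ) := C.networkError with hB₁
  set B₂ : Set (Fin N → Fin m → ℝ) :=
    {y | ∃ j, (fun τ => y τ j) ∈ atypical (q j) (δ * Real.log 2) N} with hB₂
  -- Only requirement (i) enters the converse. Wrongly decoded, atypical and remaining blocks have
  -- mass at most a quarter each, which cannot add up to one.
  have h₁ : massOf w B₁ ≤ ENNReal.ofReal (1 / 4) := hrel.indep
  have h₂ : massOf w B₂ ≤ ENNReal.ofReal (1 / 4) :=
    (massOf_exists_le (indepPMF q) (fun j y => y j) (c := c) fun j => by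
      rw [indepPMF_map_eval]
      exact hat j).trans hmc
  have h₃ : massOf w (B₁ ∪ B₂)ᶜ < ENNReal.ofReal (1 / 4) := by
    refine lt_of_le_of_lt (massOf_decoded_le C q hW ht (R := (B₁ ∪ B₂)ᶜ)
      (fun y hy hy' => hy (Or.inl hy'))
      (b := fun j => ENNReal.ofReal (Real.exp (-(N * (natEntropy (q j) - δ * Real.log 2)))))
      fun y hy j _ => iidMass_le_of_typical hN0 fun hy' => hy (Or.inr ⟨j, hy'⟩)) ?_
    rw [← ENNReal.ofReal_prod_of_nonneg fun j _ => (Real.exp_pos _).le,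
      ← ENNReal.ofReal_natCast, ← ENNReal.ofReal_mul (prod_nonneg fun j _ => (Real.exp_pos _).le),
      ENNReal.ofReal_lt_ofReal_iff (by norm_num)]
    refine lt_of_le_of_lt ?_ hNexp
    rw [C.card_cutSymbol, ← Real.exp_sum, Real.rpow_def_of_pos two_pos, ← Real.exp_add]
    refine Real.exp_le_exp.2 ?_
    have h₄ : ∑ e ∈ G.cutEdges W, C.edgeBits e ≤ N * (G.cutCapacity W + γ / 4) := by
      calc ∑ e ∈ G.cutEdges W, C.edgeBits e ≤ ∑ e ∈ G.cutEdges W, (N : ℝ) * (G.cap e + η) :=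
            sum_le_sum fun e _ => hbits e
        _ = N * (G.cutCapacity W + (G.cutEdges W).card * η) := by
            rw [← mul_sum, sum_add_distrib, G.coe_cutCapacity]
            simp
        _ ≤ N * (G.cutCapacity W + γ / 4) := by
            have h₅ : ((G.cutEdges W).card : ℝ) ≤ ν := by
              exact_mod_cast card_le_univ (G.cutEdges W)
            have h₆ : (G.cutEdges W).card * η ≤ γ / 4 := le_trans (by gcongr) hην
            gcongr
    have h₇ : ∑ j ∈ A, -(N * (natEntropy (q j) - δ * Real.log 2)) =
        -(N * (∑ j ∈ A, entropy (q j) - A.card * δ) * Real.log 2) := by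
      simp only [natEntropy_eq]
      rw [sum_neg_distrib, ← mul_sum, sum_sub_distrib, ← sum_mul, sum_const, nsmul_eq_mul]
      ring
    have h₈ : A.card * δ ≤ γ / 4 := by
      have h₉ : (A.card : ℝ) ≤ m := by exact_mod_cast (card_le_univ A).trans_eq (by simp)
      exact le_trans (by gcongr) hδm
    rw [h₇]
    have h₁₀ : Real.log 2 * ∑ e ∈ G.cutEdges W, C.edgeBits e ≤
        Real.log 2 * (N * (G.cutCapacity W + γ / 4)) := by gcongr
    have h₁₁ : (N : ℝ) * (∑ j ∈ A, entropy (q j) - γ / 4) * Real.log 2 ≤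
        N * (∑ j ∈ A, entropy (q j) - A.card * δ) * Real.log 2 := by gcongr
    have h₁₂ : ∑ j ∈ A, entropy (q j) = G.cutCapacity W + γ := by rw [hγdef]; ring
    rw [h₁₂] at h₁₁ ⊢
    linarith
  have htotal : (1 : ℝ≥0∞) ≤ massOf w B₁ + massOf w B₂ + massOf w (B₁ ∪ B₂)ᶜ := by
    rw [← tsum_iidMass (indepPMF q) N, massOf, massOf, massOf, ← ENNReal.tsum_add,
      ← ENNReal.tsum_add]
    refine ENNReal.tsum_le_tsum fun y => ?_
    by_cases hy₁ : y ∈ B₁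
    · rw [Set.indicator_of_mem hy₁, add_assoc]
      exact le_self_add
    by_cases hy₂ : y ∈ B₂
    · rw [Set.indicator_of_mem hy₂]
      exact le_add_right le_add_self
    · rw [Set.indicator_of_mem (s := (B₁ ∪ B₂)ᶜ) (by simp [hy₁, hy₂])]
      exact le_add_self
  have hlast : massOf w B₁ + massOf w B₂ + massOf w (B₁ ∪ B₂)ᶜ ≤ ENNReal.ofReal (3 / 4) := by
    refine (add_le_add (add_le_add h₁ h₂) h₃.le).trans_eq ?_
    rw [← ENNReal.ofReal_add (by norm_num) (by norm_num),
      ← ENNReal.ofReal_add (by norm_num) (by norm_num)]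
    norm_num
  have := htotal.trans hlast
  rw [← ENNReal.ofReal_one, ENNReal.ofReal_le_ofReal_iff (by norm_num)] at this
  norm_num at this

/-- If all active sources share one node, the cut condition for all of them is the strongest. -/
lemma le_minCut_of_common_source [Fintype E] {x : Fin m → ℝ} (hx : ∀ j, 0 ≤ x j)
    (hsame : ∀ j j', G.source (act j) = G.source (act j')) {t : Fin T}
    (h : ENNReal.ofReal (∑ j, x j) ≤ G.minCut act univ t) (A : Finset (Fin m)) :
    ENNReal.ofReal (∑ j ∈ A, x j) ≤ G.minCut act A t := by
  rcases A.eq_empty_or_nonempty with rfl | ⟨j₀, hj₀⟩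
  · simp
  · refine le_iInf₂ fun W hW => ?_
    refine (ENNReal.ofReal_le_ofReal ?_).trans
      (h.trans (iInf₂_le W ⟨fun j _ => hsame j₀ j ▸ hW.1 j₀ hj₀, hW.2⟩))
    exact sum_le_sum_of_subset_of_nonneg (subset_univ A) fun j _ _ => hx j

end Converse

/-! ### The rate region and the decoding complexity -/

theorem theorem2 {V E : Type*} [Fintype E] {n T m k : ℕ} (G : Network V E n T)
    (hk : 1 ≤ k) (hkn : k ≤ n) (ρ : ℝ) (hρ : 0 < ρ)
    (hm : IsLeast {r : ℕ | ρ * k * Real.log ((n : ℝ) / k) ≤ r} m)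
    (p : PMF (Fin n → ℝ)) (Φ : Matrix (Fin n) (Fin n) ℝ) (act : Fin m ↪ Fin n)
    (hp : SparselyCorrelated p Φ k act)
    (hH : ∀ j, FiniteEntropy (sourceLaw p (act j))) :
    -- the scheme works exactly above the min-cut rates given by the entropies
    (SupportsSDCIC G p Φ k act ↔
      ∀ t, ∀ A : Finset (Fin m),
        ENNReal.ofReal (∑ j ∈ A, entropy (sourceLaw p (act j))) ≤ G.minCut act A t) ∧
    -- in particular, the min-cut rate required between each receiver and the active sources
    (SupportsSDCIC G p Φ k act →
      ∀ t, ENNReal.ofReal (∑ j, entropy (sourceLaw p (act j))) ≤ G.minCut act Finset.univ t) ∧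
    -- and this rate alone suffices when the active sources enter the network at one node
    ((∀ j j', G.source (act j) = G.source (act j')) →
      (∀ t, ENNReal.ofReal (∑ j, entropy (sourceLaw p (act j))) ≤
        G.minCut act Finset.univ t) → SupportsSDCIC G p Φ k act) ∧
    -- decoding complexity of every code of the scheme at every receiver
    (∀ (N : ℕ), 0 < N → ∀ (C : SDCICCode G act N) (t : Fin T),
      IsLeast (Set.range fun D : C.Decoder t => D.complexity)
        (C.ncComplexity t + csComplexity m n)) := by
  exact ⟨⟨fun h t A => le_minCut_of_supportsSDCIC hH h t A,
      fun h => supportsSDCIC_of_le_minCut hk hkn hp hH h⟩,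
    fun h t => le_minCut_of_supportsSDCIC hH h t Finset.univ,
    fun hsame h => supportsSDCIC_of_le_minCut hk hkn hp hH fun t A =>
      le_minCut_of_common_source (fun _ => entropy_nonneg _) hsame (h t) A,
    fun _ hN C t => C.isLeast_complexity hN t⟩
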